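/- Let $n,m\ge 1$. For a Hilbert space $H$ and a unitary $U=(U_{ij})\in M_n(B(H))$ put $\mathfrak B_n(U)=\{I\}\cup\{U_{ij},U_{ij}^*\}_{i,j}$. Let $\mathcal U_{nc}(n)$ be the universal unital $C^*$-algebra generated by the entries $u_{ij}$ of an $n\times n$ unitary matrix, and let $\mathcal V_n=\operatorname{span}\{1,u_{ij},u_{ij}^*\}\subseteq\mathcal U_{nc}(n)$, an operator system; write $v_{k\ell}$ for the generators of $\mathcal V_m$. Identify $(x_{ijk\ell})$ with $\sum x_{ijk\ell}\,E_{ij}\otimes E_{k\ell}\in M_n\otimes M_m$, and define subsets of $M_n\otimes M_m$ as follows. - $B_{qc}(n,m)$ is the set of all $(\langle U_{ij}V_{k\ell}\psi,\psi\rangle)_{i,j,k,\ell}$, where $U\in M_n(B(H))$ and $V\in M_m(B(H))$ are unitary for some Hilbert space $H$, $XY=YX$ for all $X\in\mathfrak B_n(U)$ and $Y\in\mathfrak B_m(V)$, and $\psi\in H$ is a unit vector. - $B_{loc}(n,m)$ is the set of those elements of $B_{qc}(n,m)$ arising from $U,V$ for which $C^*(\mathfrak B_n(U)\cup\mathfrak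 B_m(V))$ is commutative. - $B_{qa}(n,m)$ is the set of all $(s(u_{ij}\otimes v_{k\ell}))_{i,j,k,\ell}$, where $s$ is a state on the minimal operator system tensor product $\mathcal V_n\otimes_{\min}\mathcal V_m$. - $B_{qmax}(n,m)$ is the set of all $(s(u_{ij}\otimes v_{k\ell}))_{i,j,k,\ell}$, where $s$ is a state on the maximal operator system tensor product $\mathcal V_n\otimes_{\max}\mathcal V_m$. Let $t\in\{loc,qa,qc,qmax\}$, and let $\|X\|_t=\inf\{r>0: X\in r\,B_t(n,m)\}$ be the Minkowski functional of $B_t(n,m)$. Then $\|\cdot\|_t$ is a norm on $M_n\otimes M_m$ whose closed unit ball is $B_t(n,m)$, and it is a reasonable cross-norm, where $M_n$ and $M_m$ carry the operator norm: $\|X\otimes Y\|_t\le\|X\|\,\|Y\|$ for all $X\in M_n$, $Y\in M_m$, and $|(\varphi\otimes\psi)(u)|\le\|\varphi\|\,\|\psi\|$ for all $\varphi\in M_n^*$, $\psi\in M_m^*$ and all $u\in M_n\otimes M_m$ with $\|u\|_t\le1$. Moreover, $\|u\|\le\|u\|_t$ for all $u\in M_n\otimes M_m$, where $\|\cdot\|$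 is the operator norm on $M_{nm}\cong M_n\otimes M_m$. -/

import Mathlib

open scoped TensorProduct ENNReal ComplexOrder Matrix.Norms.L2Operator

universe u

noncomputable section

namespace UnitaryCorrelation

/-! ### Concrete operator systems and states on their tensor products -/

/-- A (concrete) operator system: a unital self-adjoint subspace of a unital C*-algebra. -/
structure OperatorSystem (A : Type*) [CStarAlgebra A] where
  carrier : Submodule ℂ A
  one_mem : (1 : A) ∈ carrier
  star_mem : ∀ a ∈ carrier, star a ∈ carrier

namespace OperatorSystem

variable {A B : Type*} [CStarAlgebra A] [CStarAlgebra B]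

/-- The unit of the operator system. -/
def unit (S : OperatorSystem A) : S.carrier := ⟨1, S.one_mem⟩

/-- The cone `M_p(S)₊ = M_p(S) ∩ M_p(A)₊`. The positive elements of the
C*-algebra `M_p(A)` are those of the form `Y⋆ Y`. -/
def MatPos (S : OperatorSystem A) {p : ℕ} (X : Matrix (Fin p) (Fin p) S.carrier) : Prop :=
  ∃ Y : Matrix (Fin p) (Fin p) A, (X.map fun x => (x : A)) = Y.conjTranspose * Y

/-- Unital completely positive maps `S → M_p`. The amplification `φ^(k)` of `φ` sends
`M_k(S)` to `M_k(M_p) = M_{kp}`. -/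
structure IsUCP (S : OperatorSystem A) {p : ℕ}
    (φ : S.carrier →ₗ[ℂ] Matrix (Fin p) (Fin p) ℂ) : Prop where
  map_unit : φ S.unit = 1
  map_pos : ∀ (k : ℕ) (X : Matrix (Fin k) (Fin k) S.carrier), S.MatPos X →
    (Matrix.of fun a b : Fin k × Fin p => φ (X a.1 b.1) a.2 b.2).PosSemidef

/-- The positive cone of `S ⊗_min T`: all `(φ ⊗ ψ)(x)`, for ucp maps `φ : S → M_p` and
`ψ : T → M_q`, are positive in `M_p ⊗ M_q = M_{pq}`. (Such an `x` is self-adjoint, because the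
maps `φ ⊗ ψ` separate the points of `S ⊗ T`.) -/
def MinPos (S : OperatorSystem A) (T : OperatorSystem B)
    (x : S.carrier ⊗[ℂ] T.carrier) : Prop :=
  ∀ (p q : ℕ) (φ : S.carrier →ₗ[ℂ] Matrix (Fin p) (Fin p) ℂ)
    (ψ : T.carrier →ₗ[ℂ] Matrix (Fin q) (Fin q) ℂ), S.IsUCP φ → T.IsUCP ψ →
      (kroneckerLinearEquiv (Fin p) (Fin p) (Fin q) (Fin q) ℂ
        (TensorProduct.map φ ψ x)).PosSemidef

/-- The positive cone of `S ⊗_max T`: for each `ε > 0` one has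
`x + ε (1 ⊗ 1) = a⋆ (P ⊗ Q) a` with `P ∈ M_p(S)₊`, `Q ∈ M_q(T)₊` and `a : ℂ → ℂ^p ⊗ ℂ^q` linear,
that is, a column of scalars `a (i, k)`. -/
def MaxPos (S : OperatorSystem A) (T : OperatorSystem B)
    (x : S.carrier ⊗[ℂ] T.carrier) : Prop :=
  ∀ ε : ℝ, 0 < ε → ∃ (p q : ℕ) (P : Matrix (Fin p) (Fin p) S.carrier)
    (Q : Matrix (Fin q) (Fin q) T.carrier) (a : Fin p × Fin q → ℂ),
      S.MatPos P ∧ T.MatPos Q ∧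
      x + (ε : ℂ) • (S.unit ⊗ₜ[ℂ] T.unit) =
        ∑ i : Fin p × Fin q, ∑ j : Fin p × Fin q,
          (star (a i) * a j) • (P i.1 j.1 ⊗ₜ[ℂ] Q i.2 j.2)

/-- States on `S ⊗_min T`: unital positive linear functionals. -/
structure IsMinState (S : OperatorSystem A) (T : OperatorSystem B)
    (s : S.carrier ⊗[ℂ] T.carrier →ₗ[ℂ] ℂ) : Prop where
  map_unit : s (S.unit ⊗ₜ[ℂ] T.unit) = 1
  map_pos : ∀ x, S.MinPos T x → 0 ≤ s x

/-- States on `S ⊗_max T`: unital positive linear functionals. -/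
structure IsMaxState (S : OperatorSystem A) (T : OperatorSystem B)
    (s : S.carrier ⊗[ℂ] T.carrier →ₗ[ℂ] ℂ) : Prop where
  map_unit : s (S.unit ⊗ₜ[ℂ] T.unit) = 1
  map_pos : ∀ x, S.MaxPos T x → 0 ≤ s x

end OperatorSystem

/-! ### The universal C*-algebra of an `n × n` unitary and the operator system `𝒱_n` -/

/-- The separable infinite-dimensional Hilbert space `ℓ²(ℕ)`. -/
abbrev Ell2 : Type := lp (fun _ : ℕ => ℂ) 2

instance instNontrivialEll2 : Nontrivial Ell2 :=
  ⟨0, lp.single 2 0 1, fun h => by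
    have := congrArg (fun f : Ell2 => f 0) h
    simp at this⟩

/-- The unitaries of `M_n(B(ℓ²(ℕ)))`. -/
abbrev UnitaryMatrices (n : ℕ) : Type :=
  unitary (Matrix (Fin n) (Fin n) (Ell2 →L[ℂ] Ell2))

/-- The C*-algebra of bounded functions from the unitaries of `M_n(B(ℓ²(ℕ)))` to `B(ℓ²(ℕ))`. -/
abbrev BoundedFamilies (n : ℕ) : Type :=
  lp (fun _ : UnitaryMatrices n => Ell2 →L[ℂ] Ell2) ∞

instance instCStarAlgebraBoundedFamilies (n : ℕ) : CStarAlgebra (BoundedFamilies n) where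
  toCompleteSpace := inferInstance

theorem norm_entry_le_one {H : Type*} [NormedAddCommGroup H] [InnerProductSpace ℂ H]
    [CompleteSpace H] {n : ℕ} {U : Matrix (Fin n) (Fin n) (H →L[ℂ] H)}
    (hU : U ∈ unitary (Matrix (Fin n) (Fin n) (H →L[ℂ] H))) (i j : Fin n) : ‖U i j‖ ≤ 1 := by
  refine ContinuousLinearMap.opNorm_le_bound _ zero_le_one fun x => ?_
  rw [one_mul]
  have h1 : (∑ k, star (U k j) * U k j) = (1 : H →L[ℂ] H) := by
    have := congrFun (congrFun (Unitary.mem_iff.1 hU).1 j) j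
    simpa [Matrix.mul_apply, Matrix.star_apply] using this
  have h2 : ∑ k, ‖U k j x‖ ^ 2 = ‖x‖ ^ 2 := by
    have h3 := congrArg (fun T : H →L[ℂ] H => inner ℂ x (T x)) h1
    simp only [sum_apply, inner_sum, mul_apply_eq_comp,
      ContinuousLinearMap.star_eq_adjoint, ContinuousLinearMap.adjoint_inner_right,
      one_apply_eq_self, inner_self_eq_norm_sq_to_K] at h3
    exact_mod_cast h3
  have h4 : ‖U i j x‖ ^ 2 ≤ ‖x‖ ^ 2 :=
    h2 ▸ Finset.single_le_sum (f := fun k => ‖U k j x‖ ^ 2) (fun _ _ => sq_nonneg _)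
      (Finset.mem_univ i)
  exact (sq_le_sq₀ (norm_nonneg _) (norm_nonneg _)).1 h4

/-- The family of all `(i, j)` entries, `W ↦ W i j`. -/
def coordinate {n : ℕ} (i j : Fin n) : BoundedFamilies n :=
  ⟨fun W => W.1 i j,
    memℓp_infty ⟨1, by rintro _ ⟨W, rfl⟩; exact norm_entry_le_one W.2 i j⟩⟩

/-- The C*-algebra generated by the coordinates, as a subalgebra of `BoundedFamilies n`. -/
def uncSubalgebra (n : ℕ) : StarSubalgebra ℂ (BoundedFamilies n) :=
  (StarAlgebra.adjoin ℂ {a | ∃ i j : Fin n, a = coordinate i j}).topologicalClosure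

/-- Brown's algebra `𝒰_nc(n)`, the universal unital C*-algebra generated by the entries of an
`n × n` unitary matrix. A unital C*-algebra generated by the entries of a unitary matrix
is separable, so it has a faithful representation on `ℓ²(ℕ)` (unless it is zero); hence the C*-algebra
generated by the coordinates over all unitaries of `M_n(B(ℓ²(ℕ)))` is the universal one. -/
abbrev Unc (n : ℕ) : Type := uncSubalgebra n

instance instCStarAlgebraUnc (n : ℕ) : CStarAlgebra (Unc n) :=
  StarSubalgebra.cstarAlgebra (uncSubalgebra n)
    (h_closed := StarSubalgebra.isClosed_topologicalClosure _)

/-- The generators `u_{ij}` of `𝒰_nc(n)`. -/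
def gen {n : ℕ} (i j : Fin n) : Unc n :=
  ⟨coordinate i j, StarSubalgebra.le_topologicalClosure _ (StarAlgebra.subset_adjoin ℂ _ ⟨i, j, rfl⟩)⟩

/-- The set `{1} ∪ {u_{ij}, u_{ij}⋆}`. -/
def entrySet {R : Type*} [One R] [Star R] {n : ℕ} (U : Matrix (Fin n) (Fin n) R) : Set R :=
  {1} ∪ {x | ∃ i j, x = U i j ∨ x = star (U i j)}

/-- The operator system `𝒱_n = span {1, u_{ij}, u_{ij}⋆} ⊆ 𝒰_nc(n)`. -/
def V (n : ℕ) : OperatorSystem (Unc n) where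
  carrier := Submodule.span ℂ (entrySet (Matrix.of fun i j : Fin n => gen i j))
  one_mem := Submodule.subset_span (Or.inl rfl)
  star_mem := by
    intro a ha
    induction ha using Submodule.span_induction with
    | mem x hx =>
      refine Submodule.subset_span ?_
      rcases hx with rfl | ⟨i, j, rfl | rfl⟩
      · exact Or.inl (star_one _)
      · exact Or.inr ⟨i, j, Or.inr rfl⟩
      · exact Or.inr ⟨i, j, Or.inl (star_star _)⟩
    | zero => rw [star_zero]; exact Submodule.zero_mem _
    | add x y _ _ hx hy => rw [star_add]; exact Submodule.add_mem _ hx hy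
    | smul c x _ hx => rw [star_smul]; exact Submodule.smul_mem _ _ hx

/-- The generators `u_{ij}`, as elements of `𝒱_n`. -/
def V.gen {n : ℕ} (i j : Fin n) : (V n).carrier :=
  ⟨UnitaryCorrelation.gen i j, Submodule.subset_span (Or.inr ⟨i, j, Or.inl rfl⟩)⟩

/-! ### Unitary correlations and their norms -/

/-- The vector space `M_n ⊗ M_m`. -/
abbrev MatTensor (n m : ℕ) : Type :=
  Matrix (Fin n) (Fin n) ℂ ⊗[ℂ] Matrix (Fin m) (Fin m) ℂ

/-- The tensor `∑ x_{ijkl} E_{ij} ⊗ E_{kl}` with the given coordinates. -/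
def ofCoords {n m : ℕ} (x : Fin n → Fin n → Fin m → Fin m → ℂ) : MatTensor n m :=
  ∑ i, ∑ j, ∑ k, ∑ l, x i j k l • (Matrix.single i j (1 : ℂ) ⊗ₜ[ℂ] Matrix.single k l (1 : ℂ))

/-- Unitaries `U ∈ M_n(B(H))` and `W ∈ M_m(B(H))` such that `XY = YX` for all
`X ∈ {1, U_{ij}, U_{ij}⋆}` and `Y ∈ {1, W_{kl}, W_{kl}⋆}`. -/
structure IsCommutingPair {H : Type*} [NormedAddCommGroup H] [InnerProductSpace ℂ H]
    [CompleteSpace H] {n m : ℕ} (U : Matrix (Fin n) (Fin n) (H →L[ℂ] H))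
    (W : Matrix (Fin m) (Fin m) (H →L[ℂ] H)) : Prop where
  left_unitary : U ∈ unitary (Matrix (Fin n) (Fin n) (H →L[ℂ] H))
  right_unitary : W ∈ unitary (Matrix (Fin m) (Fin m) (H →L[ℂ] H))
  commute : ∀ X ∈ entrySet U, ∀ Y ∈ entrySet W, X * Y = Y * X

/-- The tensor with coordinates `⟨U_{ij} W_{kl} ψ, ψ⟩` (linear in the first slot). -/
def vectorCorrelation {H : Type*} [NormedAddCommGroup H] [InnerProductSpace ℂ H]
    {n m : ℕ} (U : Matrix (Fin n) (Fin n) (H →L[ℂ] H))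
    (W : Matrix (Fin m) (Fin m) (H →L[ℂ] H)) (ψ : H) : MatTensor n m :=
  ofCoords fun i j k l => inner ℂ ψ (U i j (W k l ψ))

/-- The set `B_qc(n,m)`. -/
def Bqc (n m : ℕ) : Set (MatTensor n m) :=
  {x | ∃ (H : Type u) (_ : NormedAddCommGroup H) (_ : InnerProductSpace ℂ H) (_ : CompleteSpace H)
    (U : Matrix (Fin n) (Fin n) (H →L[ℂ] H)) (W : Matrix (Fin m) (Fin m) (H →L[ℂ] H)) (ψ : H),
    IsCommutingPair U W ∧ ‖ψ‖ = 1 ∧ x = vectorCorrelation U W ψ}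

/-- The set `B_loc(n,m)`: as `B_qc(n,m)`, but the C*-algebra generated by the entries of `U` and
`W` has to be commutative. -/
def Bloc (n m : ℕ) : Set (MatTensor n m) :=
  {x | ∃ (H : Type u) (_ : NormedAddCommGroup H) (_ : InnerProductSpace ℂ H) (_ : CompleteSpace H)
    (U : Matrix (Fin n) (Fin n) (H →L[ℂ] H)) (W : Matrix (Fin m) (Fin m) (H →L[ℂ] H)) (ψ : H),
    IsCommutingPair U W ∧
    (∀ a ∈ (StarAlgebra.adjoin ℂ (entrySet U ∪ entrySet W)).topologicalClosure,
      ∀ b ∈ (StarAlgebra.adjoin ℂ (entrySet U ∪ entrySet W)).topologicalClosure,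
        a * b = b * a) ∧
    ‖ψ‖ = 1 ∧ x = vectorCorrelation U W ψ}

/-- The set `B_qa(n,m) = B_qmin(n,m)`, given by the states on `𝒱_n ⊗_min 𝒱_m`. -/
def Bqa (n m : ℕ) : Set (MatTensor n m) :=
  {x | ∃ s : (V n).carrier ⊗[ℂ] (V m).carrier →ₗ[ℂ] ℂ, (V n).IsMinState (V m) s ∧
    x = ofCoords fun i j k l => s (V.gen i j ⊗ₜ[ℂ] V.gen k l)}

/-- The set `B_qmax(n,m)`, given by the states on `𝒱_n ⊗_max 𝒱_m`. -/
def Bqmax (n m : ℕ) : Set (MatTensor n m) :=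
  {x | ∃ s : (V n).carrier ⊗[ℂ] (V m).carrier →ₗ[ℂ] ℂ, (V n).IsMaxState (V m) s ∧
    x = ofCoords fun i j k l => s (V.gen i j ⊗ₜ[ℂ] V.gen k l)}

/-- The index `t ∈ {loc, qa, qc, qmax}`. -/
inductive CorrelationType
  | loc
  | qa
  | qc
  | qmax

/-- The correlation set `B_t(n,m)`. The Hilbert spaces in the cases `loc` and `qc` range over
the universe `u`; the set does not depend on `u`, as one may restrict to separable spaces. -/
def correlationSet (t : CorrelationType) (n m : ℕ) : Set (MatTensor n m) :=
  match t with
  | .loc => Bloc.{u} n m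
  | .qa => Bqa n m
  | .qc => Bqc.{u} n m
  | .qmax => Bqmax n m

/-- The norm `‖·‖_t` on `M_n ⊗ M_m` with unit ball `B_t(n,m)`: the Minkowski functional of this
set. -/
def correlationNorm (t : CorrelationType) (n m : ℕ) : MatTensor n m → ℝ :=
  gauge (correlationSet.{u} t n m)

/-- The operator norm on `M_{nm}`, carried over to `M_n ⊗ M_m` by the Kronecker product. -/
def operatorNorm {n m : ℕ} (x : MatTensor n m) : ℝ :=
  ‖kroneckerLinearEquiv (Fin n) (Fin n) (Fin m) (Fin m) ℂ x‖

/-- Reasonable cross-norms on the tensor product of two complex normed spaces. -/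
structure IsReasonableCrossNorm {X Y : Type*} [NormedAddCommGroup X] [NormedSpace ℂ X]
    [NormedAddCommGroup Y] [NormedSpace ℂ Y] (α : X ⊗[ℂ] Y → ℝ) : Prop where
  nonneg : ∀ x, 0 ≤ α x
  eq_zero_iff : ∀ x, α x = 0 ↔ x = 0
  add_le : ∀ x y, α (x + y) ≤ α x + α y
  smul_eq : ∀ (c : ℂ) x, α (c • x) = ‖c‖ * α x
  tmul_le : ∀ x y, α (x ⊗ₜ[ℂ] y) ≤ ‖x‖ * ‖y‖
  dual_le : ∀ (φ : X →L[ℂ] ℂ) (ψ : Y →L[ℂ] ℂ) (u : X ⊗[ℂ] Y), α u ≤ 1 →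
    ‖TensorProduct.dualDistrib ℂ X Y (φ.toLinearMap ⊗ₜ[ℂ] ψ.toLinearMap) u‖ ≤ ‖φ‖ * ‖ψ‖

end UnitaryCorrelation

end

noncomputable section

namespace UnitaryCorrelation

/-! ### Contractions and unitaries -/

/-! The Kronecker product carries `B_t` to a set `B` of `nm × nm` matrices, and
`isReasonableCrossNorm_gauge` reduces the theorem to five properties of `B`: it is closed, convex,
stable under unimodular scalars, contains `U ⊗ V` for scalar unitaries, and lies in the
operator-norm unit ball. Indeed, every contraction in `M_n` is a limit of averages of two unitaries,
so `B` contains all `X ⊗ Y` with `X`, `Y` contractions. In particular it contains all tensors of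
matrix units, and being convex and balanced it is a neighbourhood of `0`. Its gauge therefore has
`B` as closed unit ball, and it dominates the operator norm, which in turn dominates every `|(φ ⊗
ψ)(u)|` with `‖φ‖, ‖ψ‖ ≤ 1` (`norm_dualDistrib_le`).

For `qa` and `qmax`, `B` consists of the values of states at fixed elements. States form a convex
set, compact for pointwise convergence because they are pointwise bounded
(`isClosed_functionalImage`). Phases come from the ucp maps `u_{ij} ↦ c u_{ij}`, and scalar
unitaries give product states. Since the maximal cone lies in the minimal one (`MaxPos.minPos`),
states for min are states for max, so the norm bound is needed only for max. It follows by
compressing the positive element `[[1, u], [u⋆, 1]] ⊗ [[1, v], [v⋆, 1]]`.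

For `loc` and `qc`, the direct sum of one representing pair for each correlation is a single pair
over one C*-algebra, and by GNS `B` is exactly the set of values of its states
(`exists_vectorSet_eq_functionalImage`). Closedness and convexity then follow as before, and the
norm bound is Cauchy–Schwarz in `H^{nm}`. -/

/-- Polar decomposition `x = w|x|`: invertibility makes `w` unitary, and the self-adjoint
contraction `|x|` is the real part of the unitary `|x| + i √(1 - |x|²)`. -/
theorem exists_unitary_add_unitary {A : Type*} [CStarAlgebra A] {x : A} (hx : IsUnit x)
    (h : ‖x‖ ≤ 1) : ∃ u ∈ unitary A, ∃ v ∈ unitary A, x = (2⁻¹ : ℝ) • (u + v) := by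
  let _ := CStarAlgebra.spectralOrder A
  let _ := CStarAlgebra.spectralOrderedRing A
  have habs : IsUnit (CFC.abs x) := by
    have h1 : IsUnit (CFC.abs x * CFC.abs x) := by
      rw [CFC.abs_mul_abs]; exact hx.star.mul hx
    exact ((Commute.refl (CFC.abs x)).isUnit_mul_iff.1 h1).1
  have hsa : IsSelfAdjoint (CFC.abs x) := (CFC.abs_nonneg x).isSelfAdjoint
  obtain ⟨p, hp⟩ := habs
  have hpstar : star (↑p⁻¹ : A) = ↑p⁻¹ := by
    have h1 : star p = p := Units.ext (by rw [Units.coe_star, hp]; exact hsa)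
    rw [← Units.coe_star, star_inv, h1]
  set w : A := x * ↑p⁻¹ with hw
  have hww : star w * w = 1 := by
    rw [hw, star_mul, hpstar, mul_assoc, ← mul_assoc (star x), ← CFC.abs_mul_abs, ← hp]
    simp
  have hwu : IsUnit w := hx.mul p⁻¹.isUnit
  have hwmem : w ∈ unitary A := by
    refine Unitary.mem_iff.2 ⟨hww, ?_⟩
    obtain ⟨q, hq⟩ := hwu
    have : star w = ↑q⁻¹ := by
      rw [← hq] at hww ⊢
      exact Units.eq_inv_of_mul_eq_one_right hww
    rw [this, ← hq, Units.mul_inv]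
  have hxw : x = w * CFC.abs x := by rw [hw, ← hp, mul_assoc, Units.inv_mul, mul_one]
  set a : selfAdjoint A := ⟨CFC.abs x, hsa⟩
  have ha : ‖a‖ ≤ 1 := by
    change ‖CFC.abs x‖ ≤ 1
    rwa [CFC.norm_abs]
  set y := selfAdjoint.unitarySelfAddISMul a ha
  refine ⟨w * y, mul_mem hwmem y.2, w * star (y : A), mul_mem hwmem (Unitary.star_mem y.2), ?_⟩
  have h2 : (2⁻¹ : ℝ) • ((y : A) + star (y : A)) = CFC.abs x := by
    rw [← realPart_apply_coe, selfAdjoint.realPart_unitarySelfAddISMul]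
  rw [← mul_add, ← mul_smul_comm, h2]
  exact hxw

/-- An invertible contraction is an average of two unitaries, so convexity handles it. Any other
contraction is a limit of invertible ones, because `-ε` avoids the finite spectrum for small `ε >
0`. -/
theorem mem_of_unitary_mem {ι E : Type*} [Fintype ι] [DecidableEq ι] [AddCommGroup E] [Module ℂ E]
    [Module ℝ E] [IsScalarTower ℝ ℂ E] [TopologicalSpace E]
    {B : Set E} (hclosed : IsClosed B) (hconv : Convex ℝ B) (f : Matrix ι ι ℂ →ₗ[ℂ] E)
    (hf : Continuous f)
    (hunit : ∀ U ∈ unitary (Matrix ι ι ℂ), f U ∈ B) {X : Matrix ι ι ℂ} (hX : ‖X‖ ≤ 1) :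
    f X ∈ B := by
  have hinv : ∀ Y : Matrix ι ι ℂ, IsUnit Y → ‖Y‖ ≤ 1 → f Y ∈ B := by
    intro Y hY hY1
    obtain ⟨u, hu, v, hv, rfl⟩ := exists_unitary_add_unitary hY hY1
    have := hconv (hunit u hu) (hunit v hv) (a := 2⁻¹) (b := 2⁻¹) (by norm_num) (by norm_num)
      (by norm_num)
    have e : f ((2⁻¹ : ℝ) • (u + v)) = (2⁻¹ : ℝ) • f u + (2⁻¹ : ℝ) • f v := by
      rw [← smul_add, ← map_add, LinearMap.map_smul_of_tower]
    rwa [e]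
  -- The factor `(1 + ε)⁻¹` keeps the perturbed matrix a contraction.
  let Z : ℝ → Matrix ι ι ℂ := fun ε => ((1 + ε)⁻¹ : ℝ) • (X + (ε : ℂ) • 1)
  have hZ : Filter.Tendsto Z (nhdsWithin 0 (Set.Ioi 0)) (nhds X) := by
    have : ContinuousAt Z 0 := by
      have h1 : ContinuousAt (fun ε : ℝ => (1 + ε)⁻¹) 0 :=
        ContinuousAt.inv₀ (by fun_prop) (by norm_num)
      have h2 : ContinuousAt (fun ε : ℝ => X + (ε : ℂ) • (1 : Matrix ι ι ℂ)) 0 := by fun_prop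
      exact h1.smul h2
    have h2 := this.tendsto
    simp only [Z, add_zero, inv_one, Complex.ofReal_zero, zero_smul, one_smul] at h2
    exact h2.mono_left nhdsWithin_le_nhds
  -- Removing `0`, which is a bad value when `X` is singular, makes the complement a neighbourhood
  -- of `0`.
  have hfin : (((fun ε : ℝ => (-ε : ℂ)) ⁻¹' spectrum ℂ X) \ {0}).Finite := by
    refine Set.Finite.subset ((Matrix.finite_spectrum X).preimage ?_) Set.sdiff_subset
    intro a _ b _ h
    simpa using h
  have hev : ∀ᶠ ε in nhdsWithin (0 : ℝ) (Set.Ioi 0), f (Z ε) ∈ B := by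
    have h1 : ∀ᶠ ε in nhdsWithin (0 : ℝ) (Set.Ioi 0),
        ε ∉ (((fun ε : ℝ => (-ε : ℂ)) ⁻¹' spectrum ℂ X) \ {0}) := by
      refine nhdsWithin_le_nhds ?_
      exact hfin.isClosed.isOpen_compl.mem_nhds (by simp)
    filter_upwards [h1, self_mem_nhdsWithin] with ε h2 (hε : 0 < ε)
    have h3 : (-ε : ℂ) ∉ spectrum ℂ X := fun h => h2 ⟨h, hε.ne'⟩
    rw [spectrum.notMem_iff] at h3
    have h4 : IsUnit (X + (ε : ℂ) • (1 : Matrix ι ι ℂ)) := by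
      have := h3.neg
      rw [Algebra.algebraMap_eq_smul_one] at this
      convert this using 1
      module
    have hpos : 0 < 1 + ε := by linarith
    refine hinv _ ?_ ?_
    · have : Z ε = (Units.mk0 (((1 + ε)⁻¹ : ℝ)) (inv_ne_zero hpos.ne')) •
          (X + (ε : ℂ) • (1 : Matrix ι ι ℂ)) := rfl
      rw [this]
      exact h4.smul _
    · have h5 : ‖X + (ε : ℂ) • (1 : Matrix ι ι ℂ)‖ ≤ 1 + ε := by
        refine (norm_add_le _ _).trans (add_le_add hX ?_)
        rw [norm_smul]
        rcases isEmpty_or_nonempty ι with h | h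
        · rw [Subsingleton.elim (1 : Matrix ι ι ℂ) 0, norm_zero, mul_zero]; exact hε.le
        · rw [norm_one, mul_one, Complex.norm_real, Real.norm_of_nonneg hε.le]
      rw [norm_smul, norm_inv, Real.norm_of_nonneg hpos.le, inv_mul_le_iff₀ hpos, mul_one]
      exact h5
  exact hclosed.mem_of_tendsto ((hf.tendsto X).comp hZ) hev

theorem kronecker_mem {n m : ℕ} {B : Set (Matrix (Fin n × Fin m) (Fin n × Fin m) ℂ)}
    (hclosed : IsClosed B) (hconv : Convex ℝ B)
    (hunit : ∀ U ∈ unitary (Matrix (Fin n) (Fin n) ℂ), ∀ V ∈ unitary (Matrix (Fin m) (Fin m) ℂ),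
      Matrix.kroneckerMap (· * ·) U V ∈ B)
    {X : Matrix (Fin n) (Fin n) ℂ} {Y : Matrix (Fin m) (Fin m) ℂ} (hX : ‖X‖ ≤ 1) (hY : ‖Y‖ ≤ 1) :
    Matrix.kroneckerMap (· * ·) X Y ∈ B := by
  refine mem_of_unitary_mem hclosed hconv
    (LinearMap.flip (Matrix.kroneckerBilinear (R := ℂ) (α := ℂ)) Y) (LinearMap.continuous_of_finiteDimensional _)
    (fun U hU => ?_) hX
  exact mem_of_unitary_mem hclosed hconv (Matrix.kroneckerBilinear (R := ℂ) (α := ℂ) U)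
    (LinearMap.continuous_of_finiteDimensional _) (hunit U hU) hY

/-! ### The operator norm of a matrix through its sesquilinear form -/

theorem sum_form_mulVec {κ : Type*} [Fintype κ] (M : Matrix κ κ ℂ) (ξ : κ → ℂ) :
    ∑ a, ∑ b, star ((M.mulVec ξ) a) * (M a b * ξ b) =
      ((‖WithLp.toLp 2 (M.mulVec ξ)‖ ^ 2 : ℝ) : ℂ) := by
  rw [EuclideanSpace.norm_sq_eq]
  push_cast
  refine Finset.sum_congr rfl fun a _ => ?_
  rw [← Finset.mul_sum]
  change star ((M.mulVec ξ) a) * (M.mulVec ξ) a = _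
  rw [mul_comm]
  exact Complex.mul_conj' _

theorem matrix_norm_le_of_forall {κ : Type*} [Fintype κ] [DecidableEq κ] (M : Matrix κ κ ℂ) {C : ℝ}
    (hC : 0 ≤ C)
    (h : ∀ ξ : κ → ℂ, ‖WithLp.toLp 2 (M.mulVec ξ)‖ ≤ C * ‖WithLp.toLp 2 ξ‖) : ‖M‖ ≤ C := by
  rw [Matrix.cstar_norm_def]
  refine ContinuousLinearMap.opNorm_le_bound _ hC fun x => ?_
  exact h x.ofLp

theorem matrix_norm_le_of_form {κ : Type*} [Fintype κ] [DecidableEq κ] (M : Matrix κ κ ℂ) {C : ℝ}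
    (hC : 0 ≤ C)
    (h : ∀ η ξ : κ → ℂ, ‖∑ a, ∑ b, star (η a) * (M a b * ξ b)‖ ≤
      C * (‖WithLp.toLp 2 η‖ * ‖WithLp.toLp 2 ξ‖)) : ‖M‖ ≤ C := by
  refine matrix_norm_le_of_forall M hC fun ξ => ?_
  have := h (M.mulVec ξ) ξ
  rw [sum_form_mulVec, Complex.norm_real, Real.norm_of_nonneg (sq_nonneg _)] at this
  by_cases h0 : ‖WithLp.toLp 2 (M.mulVec ξ)‖ = 0
  · rw [h0]; positivity
  · have hpos : 0 < ‖WithLp.toLp 2 (M.mulVec ξ)‖ := lt_of_le_of_ne (norm_nonneg _) (Ne.symm h0)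
    refine le_of_mul_le_mul_left ?_ hpos
    nlinarith

/-- At `η = Mξ` the hypothesis reads `2‖Mξ‖² ≤ ‖Mξ‖² + ‖ξ‖²`. Both norm bounds on correlation
matrices arrive in this form. -/
theorem matrix_norm_le_one_of_form {κ : Type*} [Fintype κ] [DecidableEq κ] (M : Matrix κ κ ℂ)
    (h : ∀ η ξ : κ → ℂ, 2 * ‖∑ a, ∑ b, star (η a) * (M a b * ξ b)‖ ≤
      ‖WithLp.toLp 2 η‖ ^ 2 + ‖WithLp.toLp 2 ξ‖ ^ 2) : ‖M‖ ≤ 1 := by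
  refine matrix_norm_le_of_forall M zero_le_one fun ξ => ?_
  have := h (M.mulVec ξ) ξ
  rw [sum_form_mulVec, Complex.norm_real, Real.norm_of_nonneg (sq_nonneg _)] at this
  rw [one_mul]
  exact (sq_le_sq₀ (norm_nonneg _) (norm_nonneg _)).1 (by linarith)

/-! ### Slices of a matrix -/

/-- The column `η ⊗ 1`. -/
def sliceColumn (n : ℕ) {m : ℕ} (η : Fin m → ℂ) : Matrix (Fin n × Fin m) (Fin n) ℂ :=
  Matrix.of fun a i => if a.1 = i then η a.2 else 0

/-- The Gram matrix of this column is `‖η‖² • 1`, and the C*-identity applies. -/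
theorem norm_sliceColumn_le (n : ℕ) {m : ℕ} (η : Fin m → ℂ) :
    ‖sliceColumn n η‖ ≤ ‖WithLp.toLp 2 η‖ := by
  have h1 : (sliceColumn n η).conjTranspose * sliceColumn n η =
      ((‖WithLp.toLp 2 η‖ ^ 2 : ℝ) : ℂ) • (1 : Matrix (Fin n) (Fin n) ℂ) := by
    ext i j
    rw [EuclideanSpace.norm_sq_eq]
    simp only [Matrix.mul_apply, Matrix.conjTranspose_apply, sliceColumn, Matrix.of_apply,
      Fintype.sum_prod_type, Matrix.smul_apply, Matrix.one_apply, smul_eq_mul]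
    by_cases hij : i = j
    · subst hij
      simp [Complex.conj_mul']
    · rw [if_neg hij, mul_zero]
      refine Finset.sum_eq_zero fun a _ => Finset.sum_eq_zero fun b _ => ?_
      by_cases ha : a = i
      · simp [ha, hij]
      · simp [ha]
  have h2 := Matrix.l2_opNorm_conjTranspose_mul_self (sliceColumn n η)
  rw [h1, norm_smul, Complex.norm_real, Real.norm_of_nonneg (sq_nonneg _)] at h2
  have h3 : ‖(1 : Matrix (Fin n) (Fin n) ℂ)‖ ≤ 1 := by
    rcases isEmpty_or_nonempty (Fin n) with h | h
    · rw [Subsingleton.elim (1 : Matrix (Fin n) (Fin n) ℂ) 0, norm_zero]; exact zero_le_one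
    · rw [norm_one]
  refine (sq_le_sq₀ (norm_nonneg _) (norm_nonneg _)).1 ?_
  rw [sq ‖sliceColumn n η‖, ← h2]
  exact mul_le_of_le_one_right (sq_nonneg _) h3

/-- The slice map `φ ⊗ id`. -/
def slice {n m : ℕ} (φ : Matrix (Fin n) (Fin n) ℂ →L[ℂ] ℂ)
    (M : Matrix (Fin n × Fin m) (Fin n × Fin m) ℂ) : Matrix (Fin m) (Fin m) ℂ :=
  Matrix.of fun k l => φ (Matrix.of fun i j => M (i, k) (j, l))

/-- Pairing the slice with `η` and `ξ` gives `φ` of the compression of `M` by the columns of `η` and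
`ξ`, whose norm is at most `‖η‖ ‖M‖ ‖ξ‖`. -/
theorem norm_slice_le {n m : ℕ} (φ : Matrix (Fin n) (Fin n) ℂ →L[ℂ] ℂ)
    (M : Matrix (Fin n × Fin m) (Fin n × Fin m) ℂ) : ‖slice φ M‖ ≤ ‖φ‖ * ‖M‖ := by
  refine matrix_norm_le_of_form _ (by positivity) fun η ξ => ?_
  have h1 : ∑ a, ∑ b, star (η a) * (slice φ M a b * ξ b) =
      φ ((sliceColumn n η).conjTranspose * M * sliceColumn n ξ) := by
    have h2 : (sliceColumn n η).conjTranspose * M * sliceColumn n ξ =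
        ∑ k, ∑ l, (star (η k) * ξ l) •
          (Matrix.of fun i j => M (i, k) (j, l) : Matrix (Fin n) (Fin n) ℂ) := by
      ext i j
      simp only [Matrix.mul_apply, Matrix.conjTranspose_apply, sliceColumn, Matrix.of_apply,
        Fintype.sum_prod_type, Matrix.sum_apply, Matrix.smul_apply, smul_eq_mul]
      simp only [apply_ite star, star_zero, ite_mul, zero_mul, mul_ite, mul_zero]
      rw [Finset.sum_eq_single j (by intro b _ hb; simp [hb]) (by simp)]
      simp only [if_true]
      rw [Finset.sum_comm]
      refine Finset.sum_congr rfl fun l _ => ?_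
      rw [Finset.sum_eq_single i (by intro b _ hb; simp [hb]) (by simp)]
      simp only [if_true, Finset.sum_mul]
      refine Finset.sum_congr rfl fun k _ => ?_
      ring
    rw [h2]
    simp only [map_sum, map_smul, smul_eq_mul, slice, Matrix.of_apply]
    refine Finset.sum_congr rfl fun k _ => Finset.sum_congr rfl fun l _ => ?_
    ring
  rw [h1]
  have hc : ‖(sliceColumn n η).conjTranspose‖ ≤ ‖WithLp.toLp 2 η‖ := by
    rw [Matrix.l2_opNorm_conjTranspose]; exact norm_sliceColumn_le n η
  calc _ ≤ ‖φ‖ * ‖(sliceColumn n η).conjTranspose * M * sliceColumn n ξ‖ := φ.le_opNorm _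
    _ ≤ ‖φ‖ * (‖WithLp.toLp 2 η‖ * ‖M‖ * ‖WithLp.toLp 2 ξ‖) := by
      refine mul_le_mul_of_nonneg_left ?_ (norm_nonneg _)
      refine (Matrix.l2_opNorm_mul _ _).trans ?_
      refine mul_le_mul ?_ (norm_sliceColumn_le n ξ) (norm_nonneg _) (by positivity)
      exact (Matrix.l2_opNorm_mul _ _).trans (mul_le_mul_of_nonneg_right hc (norm_nonneg _))
    _ = _ := by ring

/-- Factor `φ ⊗ ψ` as `ψ ∘ (φ ⊗ id)` and bound the slice map. -/
theorem norm_dualDistrib_le {n m : ℕ} (φ : Matrix (Fin n) (Fin n) ℂ →L[ℂ] ℂ)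
    (ψ : Matrix (Fin m) (Fin m) ℂ →L[ℂ] ℂ) (x : MatTensor n m) :
    ‖TensorProduct.dualDistrib ℂ _ _ (φ.toLinearMap ⊗ₜ[ℂ] ψ.toLinearMap) x‖ ≤
      ‖φ‖ * ‖ψ‖ * operatorNorm x := by
  have h1 : TensorProduct.dualDistrib ℂ _ _ (φ.toLinearMap ⊗ₜ[ℂ] ψ.toLinearMap) x =
      ψ (slice φ (kroneckerLinearEquiv (Fin n) (Fin n) (Fin m) (Fin m) ℂ x)) := by
    induction x using TensorProduct.induction_on with
    | zero =>
      have : slice φ (0 : Matrix (Fin n × Fin m) (Fin n × Fin m) ℂ) = 0 := by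
        ext k l
        exact φ.map_zero
      simp [this]
    | add x y hx hy =>
      have : ∀ M N : Matrix (Fin n × Fin m) (Fin n × Fin m) ℂ,
          slice φ (M + N) = slice φ M + slice φ N := by
        intro M N
        ext k l
        exact φ.map_add _ _
      rw [map_add, map_add, this, map_add, hx, hy]
    | tmul X Y =>
      rw [kroneckerLinearEquiv_tmul, TensorProduct.dualDistrib_apply]
      have : slice φ (Matrix.kroneckerMap (· * ·) X Y) = φ X • Y := by
        ext k l
        have h3 : (Matrix.of fun i j => Matrix.kroneckerMap (· * ·) X Y (i, k) (j, l) :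
            Matrix (Fin n) (Fin n) ℂ) = Y k l • X := by
          ext i j
          simp [mul_comm]
        simp only [slice, Matrix.of_apply] at h3 ⊢
        rw [h3, map_smul, Matrix.smul_apply, smul_eq_mul, smul_eq_mul, mul_comm]
      rw [this, map_smul]
      rfl
  rw [h1]
  calc _ ≤ ‖ψ‖ * ‖slice φ (kroneckerLinearEquiv (Fin n) (Fin n) (Fin m) (Fin m) ℂ x)‖ :=
        ψ.le_opNorm _
    _ ≤ ‖ψ‖ * (‖φ‖ * operatorNorm x) :=
        mul_le_mul_of_nonneg_left (norm_slice_le _ _) (norm_nonneg _)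
    _ = _ := by ring

/-! ### Minkowski functionals of unit balls between the projective and the spatial ones -/

theorem gauge_image_linearEquiv {E F : Type*} [AddCommGroup E] [Module ℂ E] [Module ℝ E]
    [IsScalarTower ℝ ℂ E] [AddCommGroup F] [Module ℂ F] [Module ℝ F] [IsScalarTower ℝ ℂ F]
    (e : E ≃ₗ[ℂ] F) (B : Set E) (x : E) : gauge (e '' B) (e x) = gauge B x := by
  rw [gauge_def', gauge_def']
  congr 1
  ext r
  have : r⁻¹ • e x = e (r⁻¹ • x) := (LinearMap.map_smul_of_tower e.toLinearMap r⁻¹ x).symm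
  simp only [Set.mem_ofPred_eq, this, e.injective.mem_set_image]

theorem eq_sum_single_kronecker {n m : ℕ} (M : Matrix (Fin n × Fin m) (Fin n × Fin m) ℂ) :
    M = ∑ p : (Fin n × Fin n) × (Fin m × Fin m), M (p.1.1, p.2.1) (p.1.2, p.2.2) •
      Matrix.kroneckerMap (· * ·) (Matrix.single p.1.1 p.1.2 (1 : ℂ))
        (Matrix.single p.2.1 p.2.2 (1 : ℂ)) := by
  ext ⟨i, k⟩ ⟨j, l⟩
  rw [Matrix.sum_apply, Finset.sum_eq_single ((i, j), (k, l))]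
  · simp
  · rintro ⟨⟨i', j'⟩, ⟨k', l'⟩⟩ _ hne
    simp only [Matrix.smul_apply, Matrix.kroneckerMap_apply, Matrix.single_apply, smul_eq_mul]
    by_cases h1 : i' = i ∧ j' = j
    · by_cases h2 : k' = k ∧ l' = l
      · exact absurd (by rw [h1.1, h1.2, h2.1, h2.2]) hne
      · simp [h2]
    · simp [h1]
  · simp

theorem norm_single_one_le {n : ℕ} (i j : Fin n) : ‖(Matrix.single i j (1 : ℂ))‖ ≤ 1 := by
  have h := Matrix.l2_opNorm_conjTranspose_mul_self (Matrix.single i j (1 : ℂ))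
  rw [Matrix.conjTranspose_single, star_one, Matrix.single_mul_single_same, mul_one,
    ← Matrix.diagonal_single, Matrix.l2_opNorm_diagonal, Pi.norm_single, norm_one] at h
  nlinarith [norm_nonneg (Matrix.single i j (1 : ℂ))]

/-- With `N` the number of coordinates, `M` is the average of the `N` terms `(N · entry) •` (tensor
of matrix units); near `0` these coefficients have modulus below `1`, so balancedness puts each term
in `B`. -/
theorem mem_nhds_zero_of_single_mem {n m : ℕ} (hn : 1 ≤ n) (hm : 1 ≤ m)
    {B : Set (Matrix (Fin n × Fin m) (Fin n × Fin m) ℂ)}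
    (hconv : Convex ℝ B) (hbal : Balanced ℂ B)
    (hsingle : ∀ i j k l, Matrix.kroneckerMap (· * ·) (Matrix.single i j (1 : ℂ))
        (Matrix.single k l (1 : ℂ)) ∈ B) : B ∈ nhds 0 := by
  set N : ℝ := (Fintype.card ((Fin n × Fin n) × (Fin m × Fin m)) : ℝ) with hN
  have : Nonempty (Fin n) := ⟨⟨0, hn⟩⟩
  have : Nonempty (Fin m) := ⟨⟨0, hm⟩⟩
  have hNpos : 0 < N := by
    rw [hN]; exact_mod_cast Fintype.card_pos
  have hev : ∀ᶠ M in nhds (0 : Matrix (Fin n × Fin m) (Fin n × Fin m) ℂ),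
      ∀ p : (Fin n × Fin n) × (Fin m × Fin m), ‖(N : ℂ) * M (p.1.1, p.2.1) (p.1.2, p.2.2)‖ < 1 := by
    rw [Filter.eventually_all]
    intro p
    have hc : Continuous fun M : Matrix (Fin n × Fin m) (Fin n × Fin m) ℂ =>
        ‖(N : ℂ) * M (p.1.1, p.2.1) (p.1.2, p.2.2)‖ := by
      have : Continuous (Matrix.entryLinearMap ℂ ℂ (p.1.1, p.2.1) (p.1.2, p.2.2)) :=
        LinearMap.continuous_of_finiteDimensional _
      exact (continuous_const.mul this).norm
    exact hc.continuousAt.eventually_lt continuousAt_const (by simp)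
  filter_upwards [hev] with M hM
  have hsum : M = ∑ p : (Fin n × Fin n) × (Fin m × Fin m), N⁻¹ •
      (((N : ℂ) * M (p.1.1, p.2.1) (p.1.2, p.2.2)) •
      Matrix.kroneckerMap (· * ·) (Matrix.single p.1.1 p.1.2 (1 : ℂ))
        (Matrix.single p.2.1 p.2.2 (1 : ℂ))) := by
    conv_lhs => rw [eq_sum_single_kronecker M]
    refine Finset.sum_congr rfl fun p _ => ?_
    rw [← Complex.coe_smul, smul_smul, ← mul_assoc]
    congr 1
    rw [Complex.ofReal_inv, inv_mul_cancel₀ (by exact_mod_cast hNpos.ne'), one_mul]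
  rw [hsum]
  refine hconv.sum_mem (fun _ _ => inv_nonneg.2 hNpos.le) ?_ fun p _ => ?_
  · rw [Finset.sum_const, Finset.card_univ, nsmul_eq_mul, mul_inv_cancel₀ hNpos.ne']
  · exact hbal.smul_mem (hM p).le (hsingle _ _ _ _)

/-- `0` is the midpoint of `x` and `-x`, and `a • x` is the convex combination of `(a/|a|) • x` and
`0` with weight `|a|`. -/
theorem balanced_of_phase {E : Type*} [AddCommGroup E] [Module ℂ E] [Module ℝ E]
    [IsScalarTower ℝ ℂ E] {B : Set E} (hconv : Convex ℝ B)
    (hphase : ∀ x ∈ B, ∀ c : ℂ, ‖c‖ = 1 → c • x ∈ B) : Balanced ℂ B := by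
  rintro a ha _ ⟨x, hx, rfl⟩
  change a • x ∈ B
  have h0 : (0 : E) ∈ B := by
    have := hconv hx (hphase x hx (-1) (by simp)) (a := 2⁻¹) (b := 2⁻¹) (by norm_num) (by norm_num)
      (by norm_num)
    simpa using this
  by_cases ha0 : a = 0
  · simpa [ha0] using h0
  have h1 : ‖a‖ ≠ 0 := norm_ne_zero_iff.2 ha0
  have h2 := hphase x hx (a / ‖a‖) (by simp [h1])
  have h3 := hconv h2 h0 (norm_nonneg a) (sub_nonneg.2 ha) (by ring)
  have h4 : ‖a‖ • (a / ‖a‖) • x = a • x := by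
    rw [← smul_assoc, Complex.real_smul, mul_div_cancel₀ _ (by exact_mod_cast h1)]
  rwa [smul_zero, add_zero, h4] at h3

/-- The common reduction for all four types. Containing products of contractions makes the gauge
finite and gives the upper cross-norm bound; lying in the operator-norm ball gives definiteness and
the dual bound. -/
theorem isReasonableCrossNorm_gauge {n m : ℕ} (hn : 1 ≤ n) (hm : 1 ≤ m) {B₀ : Set (MatTensor n m)}
    {B : Set (Matrix (Fin n × Fin m) (Fin n × Fin m) ℂ)}
    (hB : kroneckerLinearEquiv (Fin n) (Fin n) (Fin m) (Fin m) ℂ '' B₀ = B)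
    (hclosed : IsClosed B) (hconv : Convex ℝ B)
    (hphase : ∀ x ∈ B, ∀ c : ℂ, ‖c‖ = 1 → c • x ∈ B)
    (hunit : ∀ U ∈ unitary (Matrix (Fin n) (Fin n) ℂ), ∀ V ∈ unitary (Matrix (Fin m) (Fin m) ℂ),
      Matrix.kroneckerMap (· * ·) U V ∈ B)
    (hnorm : ∀ M ∈ B, ‖M‖ ≤ 1) :
    {x | gauge B₀ x ≤ 1} = B₀ ∧ IsReasonableCrossNorm (gauge B₀) ∧
      ∀ x : MatTensor n m, operatorNorm x ≤ gauge B₀ x := by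
  set e := kroneckerLinearEquiv (Fin n) (Fin n) (Fin m) (Fin m) ℂ with he
  have hg : ∀ x, gauge B₀ x = gauge B (e x) := fun x => by
    rw [← hB, gauge_image_linearEquiv]
  have hmem : ∀ x, e x ∈ B ↔ x ∈ B₀ := fun x => by
    rw [← hB, e.injective.mem_set_image]
  have hkron : ∀ (X : Matrix (Fin n) (Fin n) ℂ) (Y : Matrix (Fin m) (Fin m) ℂ), ‖X‖ ≤ 1 → ‖Y‖ ≤ 1 →
      Matrix.kroneckerMap (· * ·) X Y ∈ B := fun X Y hX hY =>
    kronecker_mem hclosed hconv hunit hX hY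
  have hbal : Balanced ℂ B := balanced_of_phase hconv hphase
  have hnhds : B ∈ nhds 0 := mem_nhds_zero_of_single_mem hn hm hconv hbal fun i j k l =>
    hkron _ _ (norm_single_one_le _ _) (norm_single_one_le _ _)
  have habs : Absorbent ℝ B := absorbent_nhds_zero hnhds
  have hop : ∀ x, operatorNorm x ≤ gauge B₀ x := fun x => by
    rw [hg]
    have := le_gauge_of_subset_closedBall (x := e x) habs zero_le_one
      (fun M hM => by simpa using hnorm M hM)
    rw [div_one] at this
    exact this
  have hsmul : ∀ (c : ℂ) x, gauge B₀ (c • x) = ‖c‖ * gauge B₀ x := fun c x => by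
    rw [hg, hg, map_smul, gauge_smul hbal]
  refine ⟨?_, ⟨?_, ?_, ?_, hsmul, ?_, ?_⟩, hop⟩
  · ext x
    rw [Set.mem_ofPred_eq, hg, gauge_le_one_iff_mem_closure hconv hnhds, hclosed.closure_eq, hmem]
  · exact fun x => gauge_nonneg x
  · intro x
    constructor
    · intro h
      have := hop x
      rw [h] at this
      have h2 : e x = 0 := norm_le_zero_iff.1 this
      exact e.map_eq_zero_iff.1 h2
    · rintro rfl
      exact gauge_zero
  · intro x y
    rw [hg, hg, hg, map_add]
    exact gauge_add_le hconv habs _ _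
  · intro X Y
    have key : ∀ (X : Matrix (Fin n) (Fin n) ℂ) (Y : Matrix (Fin m) (Fin m) ℂ), ‖X‖ ≤ 1 →
        ‖Y‖ ≤ 1 → gauge B₀ (X ⊗ₜ[ℂ] Y) ≤ 1 := fun X Y hX hY => by
      rw [hg, he, kroneckerLinearEquiv_tmul]
      exact gauge_le_one_of_mem (hkron X Y hX hY)
    by_cases hX : X = 0
    · simp [hX, gauge_zero]
    by_cases hY : Y = 0
    · simp [hY, gauge_zero]
    have hX' : (‖X‖ : ℂ) ≠ 0 := by exact_mod_cast norm_ne_zero_iff.2 hX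
    have hY' : (‖Y‖ : ℂ) ≠ 0 := by exact_mod_cast norm_ne_zero_iff.2 hY
    have h1 := key ((‖X‖ : ℂ)⁻¹ • X) ((‖Y‖ : ℂ)⁻¹ • Y)
      (by rw [norm_smul, norm_inv, Complex.norm_real, norm_norm,
            inv_mul_cancel₀ (norm_ne_zero_iff.2 hX)])
      (by rw [norm_smul, norm_inv, Complex.norm_real, norm_norm,
            inv_mul_cancel₀ (norm_ne_zero_iff.2 hY)])
    have h2 : X ⊗ₜ[ℂ] Y = ((‖X‖ : ℂ) * ‖Y‖) •
        (((‖X‖ : ℂ)⁻¹ • X) ⊗ₜ[ℂ] ((‖Y‖ : ℂ)⁻¹ • Y)) := by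
      rw [TensorProduct.smul_tmul_smul, smul_smul]
      rw [show (‖X‖ : ℂ) * ‖Y‖ * ((‖X‖ : ℂ)⁻¹ * (‖Y‖ : ℂ)⁻¹) = 1 by field_simp, one_smul]
    rw [h2, hsmul, norm_mul, Complex.norm_real, Complex.norm_real, norm_norm, norm_norm]
    exact mul_le_of_le_one_right (by positivity) h1
  · intro φ ψ x hx
    refine (norm_dualDistrib_le φ ψ x).trans ?_
    exact mul_le_of_le_one_right (by positivity) ((hop x).trans hx)

/-! ### Normalised positive functionals -/

/-- Linear functionals which take the value `1` at `e` and are nonnegative on `C`. -/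
structure IsNormalizedOn {E : Type*} [AddCommGroup E] [Module ℂ E] (C : Set E) (e : E)
    (s : E →ₗ[ℂ] ℂ) : Prop where
  map_unit : s e = 1
  map_pos : ∀ x ∈ C, 0 ≤ s x

/-- The functionals in `IsNormalizedOn C e` are pointwise bounded. -/
def PointwiseBounded {E : Type*} [AddCommGroup E] [Module ℂ E] (C : Set E) (e : E) : Prop :=
  ∀ x, ∃ c : ℝ, ∀ s, IsNormalizedOn C e s → ‖s x‖ ≤ c

theorem PointwiseBounded.mono {E : Type*} [AddCommGroup E] [Module ℂ E] {C D : Set E} {e : E}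
    (h : PointwiseBounded C e) (hCD : C ⊆ D) : PointwiseBounded D e := fun x =>
  (h x).imp fun _ hc s hs => hc s ⟨hs.map_unit, fun y hy => hs.map_pos y (hCD hy)⟩

theorem PointwiseBounded.of_span {E : Type*} [AddCommGroup E] [Module ℂ E] {C : Set E} {e : E}
    {G : Set E} (hG : Submodule.span ℂ G = ⊤)
    (h : ∀ x ∈ G, ∃ c : ℝ, ∀ s, IsNormalizedOn C e s → ‖s x‖ ≤ c) : PointwiseBounded C e := by
  intro x
  have hx : x ∈ Submodule.span ℂ G := hG ▸ Submodule.mem_top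
  induction hx using Submodule.span_induction with
  | mem x hx => exact h x hx
  | zero => exact ⟨0, fun s _ => by simp⟩
  | add x y _ _ hx hy =>
    obtain ⟨c, hc⟩ := hx
    obtain ⟨d, hd⟩ := hy
    exact ⟨c + d, fun s hs => by
      rw [map_add]; exact (norm_add_le _ _).trans (add_le_add (hc s hs) (hd s hs))⟩
  | smul a x _ hx =>
    obtain ⟨c, hc⟩ := hx
    exact ⟨‖a‖ * c, fun s hs => by
      rw [map_smul, norm_smul]
      exact mul_le_mul_of_nonneg_left (hc s hs) (norm_nonneg _)⟩

/-- The matrices with entries `s (z a b)`, for normalised positive functionals `s`. -/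
def functionalImage {E : Type*} [AddCommGroup E] [Module ℂ E] {κ : Type*} (C : Set E) (e : E)
    (z : κ → κ → E) : Set (Matrix κ κ ℂ) :=
  {M | ∃ s, IsNormalizedOn C e s ∧ M = Matrix.of fun a b => s (z a b)}

theorem convex_functionalImage {E : Type*} [AddCommGroup E] [Module ℂ E] {κ : Type*} (C : Set E)
    (e : E) (z : κ → κ → E) : Convex ℝ (functionalImage C e z) := by
  rintro _ ⟨s, hs, rfl⟩ _ ⟨t, ht, rfl⟩ a b ha hb hab
  refine ⟨(a : ℂ) • s + (b : ℂ) • t, ⟨?_, fun x hx => ?_⟩, ?_⟩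
  · simp only [LinearMap.add_apply, LinearMap.smul_apply, hs.map_unit, ht.map_unit, smul_eq_mul,
      mul_one]
    exact_mod_cast hab
  · exact add_nonneg (mul_nonneg (by exact_mod_cast ha) (hs.map_pos x hx))
      (mul_nonneg (by exact_mod_cast hb) (ht.map_pos x hx))
  · ext i j
    simp

/-- Tychonoff: normalised positive functionals form a closed subset of a product of discs, and
evaluation at the `z a b` is continuous, so the image is compact. -/
theorem isClosed_functionalImage {E : Type*} [AddCommGroup E] [Module ℂ E] {κ : Type*} [Fintype κ]
    [DecidableEq κ] {C : Set E} {e : E} (hb : PointwiseBounded C e) (z : κ → κ → E) :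
    IsClosed (functionalImage C e z) := by
  choose c hc using hb
  let K : Set (E → ℂ) := {f | (∀ x y, f (x + y) = f x + f y) ∧ (∀ (a : ℂ) x, f (a • x) = a * f x) ∧
    f e = 1 ∧ ∀ x ∈ C, 0 ≤ f x}
  have hK : IsClosed K := by
    refine IsClosed.and ?_ (IsClosed.and ?_ (IsClosed.and ?_ ?_))
    · simp only [Set.ofPred_forall]
      exact isClosed_iInter fun x => isClosed_iInter fun y =>
        isClosed_eq (continuous_apply _) (by fun_prop)
    · simp only [Set.ofPred_forall]
      exact isClosed_iInter fun a => isClosed_iInter fun x =>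
        isClosed_eq (continuous_apply _) (by fun_prop)
    · exact isClosed_eq (continuous_apply _) continuous_const
    · simp only [Set.ofPred_forall]
      exact isClosed_iInter fun x => isClosed_iInter fun _ =>
        isClosed_le continuous_const (continuous_apply _)
  have hcomp : IsCompact (K ∩ Set.pi Set.univ fun x => Metric.closedBall (0 : ℂ) (c x)) :=
    (isCompact_univ_pi fun x => isCompact_closedBall _ _).inter_left hK
  have hcont : Continuous fun f : E → ℂ => (Matrix.of fun a b => f (z a b) : Matrix κ κ ℂ) :=
    continuous_matrix fun a b => continuous_apply _
  have : functionalImage C e z = (fun f : E → ℂ => (Matrix.of fun a b => f (z a b) :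
      Matrix κ κ ℂ)) '' (K ∩ Set.pi Set.univ fun x => Metric.closedBall (0 : ℂ) (c x)) := by
    ext M
    constructor
    · rintro ⟨s, hs, rfl⟩
      refine ⟨s, ⟨⟨map_add s, fun a x => map_smul s a x, hs.map_unit, hs.map_pos⟩,
        fun x _ => ?_⟩, rfl⟩
      simpa using hc x s hs
    · rintro ⟨f, ⟨⟨hadd, hsmul, h1, hpos⟩, _⟩, rfl⟩
      exact ⟨{ toFun := f, map_add' := hadd, map_smul' := hsmul }, ⟨h1, hpos⟩, rfl⟩
  rw [this]
  exact (hcomp.image hcont).isClosed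

/-! ### Positive elements of operator systems -/

theorem exists_smul_one_sub_eq {A : Type*} [CStarAlgebra A] {a : A} (ha : IsSelfAdjoint a) :
    ∃ y : A, ((‖a‖ : ℝ) : ℂ) • (1 : A) - a = star y * y := by
  let _ := CStarAlgebra.spectralOrder A
  let _ := CStarAlgebra.spectralOrderedRing A
  have h := ha.le_algebraMap_norm_self
  rw [← sub_nonneg, CStarAlgebra.nonneg_iff_eq_star_mul_self] at h
  simpa [Algebra.algebraMap_eq_smul_one] using h

namespace OperatorSystem

variable {A B : Type*} [CStarAlgebra A] [CStarAlgebra B]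

/-- Positive elements of an operator system. -/
def Pos (S : OperatorSystem A) (x : S.carrier) : Prop := ∃ y : A, (x : A) = star y * y

/-- A self-adjoint `x` is `‖x‖1 - (‖x‖1 - x)`, a difference of positive elements still in `S`; real
and imaginary parts do the rest. -/
theorem span_pos (S : OperatorSystem A) : Submodule.span ℂ {x : S.carrier | S.Pos x} = ⊤ := by
  rw [eq_top_iff]
  have hunit : S.unit ∈ {x : S.carrier | S.Pos x} := ⟨1, by simp [unit]⟩
  have hsa : ∀ x : S.carrier, IsSelfAdjoint (x : A) →
      x ∈ Submodule.span ℂ {x : S.carrier | S.Pos x} := by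
    intro x hx
    obtain ⟨y, hy⟩ := exists_smul_one_sub_eq hx
    have h1 : ((‖(x : A)‖ : ℝ) : ℂ) • S.unit - x ∈ {x : S.carrier | S.Pos x} := ⟨y, hy⟩
    have h2 := Submodule.sub_mem _ (Submodule.smul_mem _ ((‖(x : A)‖ : ℝ) : ℂ)
      (Submodule.subset_span hunit)) (Submodule.subset_span h1)
    rwa [sub_sub_cancel] at h2
  rintro x -
  let x' : S.carrier := ⟨star (x : A), S.star_mem _ x.2⟩
  have h1 := hsa (x + x') (by
    change star ((x : A) + star (x : A)) = _
    rw [star_add, star_star, add_comm]; rfl)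
  have h2 := hsa (Complex.I • (x - x')) (by
    change star (Complex.I • ((x : A) - star (x : A))) = Complex.I • ((x : A) - star (x : A))
    rw [star_smul, star_sub, star_star, Complex.star_def, Complex.conj_I]
    module)
  have h3 := Submodule.sub_mem _ (Submodule.smul_mem _ (2⁻¹ : ℂ) h1)
    (Submodule.smul_mem _ (2⁻¹ * Complex.I : ℂ) h2)
  have h4 : (2⁻¹ : ℂ) • (x + x') - (2⁻¹ * Complex.I : ℂ) • Complex.I • (x - x') = x := by
    rw [smul_smul, mul_assoc, Complex.I_mul_I]
    module
  rwa [h4] at h3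

theorem Pos.exists_sub {S : OperatorSystem A} {x : S.carrier} (hx : S.Pos x) :
    ∃ r : ℝ, 0 ≤ r ∧ S.Pos ((r : ℂ) • S.unit - x) := by
  obtain ⟨y, hy⟩ := hx
  have hsa : IsSelfAdjoint (x : A) := by rw [hy]; exact .star_mul_self y
  obtain ⟨w, hw⟩ := exists_smul_one_sub_eq hsa
  exact ⟨‖(x : A)‖, norm_nonneg _, w, hw⟩

/-- Tensors of positive elements span, and `rt(1 ⊗ 1) - P ⊗ Q = (r1 - P) ⊗ t1 + P ⊗ (t1 - Q)` bounds
`s (P ⊗ Q)` by `rt`. -/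
theorem pointwiseBounded_tmul (S : OperatorSystem A) (T : OperatorSystem B) :
    PointwiseBounded {x : S.carrier ⊗[ℂ] T.carrier | ∃ P Q, S.Pos P ∧ T.Pos Q ∧ x = P ⊗ₜ[ℂ] Q}
      (S.unit ⊗ₜ[ℂ] T.unit) := by
  refine .of_span (G := {x | ∃ P Q, S.Pos P ∧ T.Pos Q ∧ x = P ⊗ₜ[ℂ] Q}) ?_ ?_
  · rw [eq_top_iff, ← TensorProduct.span_tmul_eq_top ℂ, Submodule.span_le]
    rintro _ ⟨x, y, rfl⟩
    have hx : x ∈ Submodule.span ℂ {x : S.carrier | S.Pos x} := S.span_pos ▸ Submodule.mem_top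
    have hy : y ∈ Submodule.span ℂ {x : T.carrier | T.Pos x} := T.span_pos ▸ Submodule.mem_top
    have h := Submodule.apply_mem_map₂ (TensorProduct.mk ℂ S.carrier T.carrier) hx hy
    rw [Submodule.map₂_span_span] at h
    refine Submodule.span_mono ?_ h
    rintro _ ⟨P, hP, Q, hQ, rfl⟩
    exact ⟨P, Q, hP, hQ, rfl⟩
  · rintro _ ⟨P, Q, hP, hQ, rfl⟩
    obtain ⟨r, hr, hP'⟩ := hP.exists_sub
    obtain ⟨t, ht, hQ'⟩ := hQ.exists_sub
    refine ⟨r * t, fun s hs => ?_⟩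
    have hTu : T.Pos ((t : ℂ) • T.unit) := ⟨((Real.sqrt t : ℝ) : ℂ) • 1, by
      rw [star_smul, star_one, smul_mul_smul_comm, mul_one, Complex.star_def, Complex.conj_ofReal,
        ← Complex.ofReal_mul, Real.mul_self_sqrt ht]
      rfl⟩
    have h0 := hs.map_pos _ ⟨P, Q, hP, hQ, rfl⟩
    have h1 := hs.map_pos _ ⟨_, _, hP', hTu, rfl⟩
    have h2 := hs.map_pos _ ⟨P, _, hP, hQ', rfl⟩
    have h3 : s (((r : ℂ) • S.unit - P) ⊗ₜ[ℂ] ((t : ℂ) • T.unit)) +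
        s (P ⊗ₜ[ℂ] ((t : ℂ) • T.unit - Q)) = ((r * t : ℝ) : ℂ) - s (P ⊗ₜ[ℂ] Q) := by
      rw [TensorProduct.sub_tmul, TensorProduct.tmul_sub, TensorProduct.smul_tmul_smul, map_sub,
        map_sub, map_smul, hs.map_unit]
      push_cast
      simp
    have h4 : s (P ⊗ₜ[ℂ] Q) ≤ ((r * t : ℝ) : ℂ) := by
      rw [← sub_nonneg, ← h3]
      exact add_nonneg h1 h2
    rw [Complex.le_def] at h0 h4
    have h5 : s (P ⊗ₜ[ℂ] Q) = ((s (P ⊗ₜ[ℂ] Q)).re : ℂ) :=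
      Complex.ext rfl (by simpa using h0.2.symm)
    rw [h5, Complex.norm_real, Real.norm_of_nonneg h0.1]
    exact h4.1

/-! ### The maximal and the minimal cone -/

theorem sum_sum_option {ι κ M : Type*} [Fintype ι] [Fintype κ] [AddCommMonoid M]
    (f : Option ι × Option κ → Option ι × Option κ → M) (h1 : ∀ i p, f (some i, none) p = 0)
    (h2 : ∀ k p, f (none, some k) p = 0) (h3 : ∀ i p, f p (some i, none) = 0)
    (h4 : ∀ k p, f p (none, some k) = 0) (h5 : ∀ i k, f (none, none) (some i, some k) = 0)
    (h6 : ∀ i k, f (some i, some k) (none, none) = 0) :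
    ∑ p, ∑ q, f p q = (∑ p : ι × κ, ∑ q : ι × κ, f (some p.1, some p.2) (some q.1, some q.2)) +
      f (none, none) (none, none) := by
  simp [Fintype.sum_prod_type, Fintype.sum_option, h1, h2, h3, h4, h5, h6, add_comm]

/-- This is `P ⊕ 1 = (Y ⊕ 1)⋆ (Y ⊕ 1)`; the extra coordinate makes room for the term `ε (1 ⊗ 1)` in
`MaxPos`. -/
theorem exists_amplification (S : OperatorSystem A) {ι : Type*} [Fintype ι]
    {P : Matrix ι ι S.carrier} {Y : Matrix ι ι A}
    (h : (P.map fun x => (x : A)) = Y.conjTranspose * Y) :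
    ∃ P' : Matrix (Option ι) (Option ι) S.carrier, (∀ i j, P' (some i) (some j) = P i j) ∧
      (∀ i, P' (some i) none = 0) ∧ (∀ j, P' none (some j) = 0) ∧ P' none none = S.unit ∧
      ∃ Y' : Matrix (Option ι) (Option ι) A,
        (P'.map fun x => (x : A)) = Y'.conjTranspose * Y' := by
  refine ⟨Matrix.of fun i j => i.elim (j.elim S.unit fun _ => 0) fun i => j.elim 0 (P i), fun _ _ => rfl,
    fun _ => rfl, fun _ => rfl, rfl,
    Matrix.of fun i j => i.elim (j.elim 1 fun _ => 0) fun i => j.elim 0 (Y i), ?_⟩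
  ext (_ | i) (_ | j)
  · simp [Matrix.mul_apply, Fintype.sum_option, unit]
  · simp [Matrix.mul_apply, Fintype.sum_option]
  · simp [Matrix.mul_apply, Fintype.sum_option]
  · have := congrFun (congrFun h i) j
    simpa [Matrix.mul_apply, Fintype.sum_option] using this

/-- The perturbation `ε (1 ⊗ 1)` is absorbed by passing to `P ⊕ 1` and `Q ⊕ 1`, with coefficient
`√ε` at the new corner and `0` at mixed indices. -/
theorem maxPos_of_sum {S : OperatorSystem A} {T : OperatorSystem B} {ι κ : Type*} [Fintype ι]
    [Fintype κ] {P : Matrix ι ι S.carrier} {Q : Matrix κ κ T.carrier} {Y : Matrix ι ι A}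
    {Z : Matrix κ κ B} (hP : (P.map fun x => (x : A)) = Y.conjTranspose * Y)
    (hQ : (Q.map fun x => (x : B)) = Z.conjTranspose * Z) (a : ι × κ → ℂ) :
    S.MaxPos T (∑ i, ∑ j, (star (a i) * a j) • (P i.1 j.1 ⊗ₜ[ℂ] Q i.2 j.2)) := by
  intro ε hε
  obtain ⟨P', hP1, hP3, hP4, hP2, Y', hY'⟩ := exists_amplification S hP
  obtain ⟨Q', hQ1, hQ3, hQ4, hQ2, Z', hZ'⟩ := exists_amplification T hQ
  let a' : Option ι × Option κ → ℂ := fun p =>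
    p.1.elim (p.2.elim (Real.sqrt ε : ℂ) fun _ => 0) fun i => p.2.elim 0 fun k => a (i, k)
  let eι := Fintype.equivFin (Option ι)
  let eκ := Fintype.equivFin (Option κ)
  refine ⟨_, _, P'.submatrix eι.symm eι.symm, Q'.submatrix eκ.symm eκ.symm,
    fun p => a' (eι.symm p.1, eκ.symm p.2), ⟨Y'.submatrix eι.symm eι.symm, ?_⟩,
    ⟨Z'.submatrix eκ.symm eκ.symm, ?_⟩, ?_⟩
  · rw [Matrix.conjTranspose_submatrix, Matrix.submatrix_mul_equiv, ← hY', Matrix.submatrix_map]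
  · rw [Matrix.conjTranspose_submatrix, Matrix.submatrix_mul_equiv, ← hZ', Matrix.submatrix_map]
  · have h1 := Equiv.sum_comp (eι.prodCongr eκ).symm fun p => ∑ q : Option ι × Option κ,
      (star (a' p) * a' q) • (P' p.1 q.1 ⊗ₜ[ℂ] Q' p.2 q.2)
    have h2 : ∀ p : Option ι × Option κ, _ := fun p => Equiv.sum_comp (eι.prodCongr eκ).symm
      fun q => (star (a' p) * a' q) • (P' p.1 q.1 ⊗ₜ[ℂ] Q' p.2 q.2)
    simp only [← h2] at h1
    refine Eq.trans ?_ h1.symm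
    simp only [h2]
    rw [sum_sum_option]
    · simp only [a', Option.elim, hP1, hQ1, hP2, hQ2, Prod.mk.eta]
      congr 2
      rw [Complex.star_def, Complex.conj_ofReal, ← Complex.ofReal_mul, Real.mul_self_sqrt hε.le]
    all_goals intros; simp [a', hP3, hP4]

/-- Ucp maps send `a⋆ (P ⊗ Q) a` to a compression of the Kronecker product of two positive
semidefinite amplifications; then `ε → 0`. -/
theorem MaxPos.minPos {S : OperatorSystem A} {T : OperatorSystem B} {x : S.carrier ⊗[ℂ] T.carrier}
    (hx : S.MaxPos T x) : S.MinPos T x := by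
  intro p q φ ψ hφ hψ
  set Φ : S.carrier ⊗[ℂ] T.carrier →ₗ[ℂ] Matrix (Fin p × Fin q) (Fin p × Fin q) ℂ :=
    (kroneckerLinearEquiv (Fin p) (Fin p) (Fin q) (Fin q) ℂ).toLinearMap ∘ₗ
      TensorProduct.map φ ψ with hΦ
  change (Φ x).PosSemidef
  have hunit : Φ (S.unit ⊗ₜ[ℂ] T.unit) = 1 := by
    simp [hΦ, hφ.map_unit, hψ.map_unit]
  have h1 : ∀ ε : ℝ, 0 < ε → (Φ x + (ε : ℂ) • 1).PosSemidef := by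
    intro ε hε
    obtain ⟨k, l, P, Q, a, hP, hQ, h⟩ := hx ε hε
    have h2 := (hφ.map_pos k P hP).kronecker (hψ.map_pos l Q hQ)
    -- The shuffle `(k × l) × (p × q) → (k × p) × (l × q)`; `D` below is `a ⊗ 1`.
    let f : (Fin k × Fin l) × (Fin p × Fin q) → (Fin k × Fin p) × (Fin l × Fin q) :=
      fun i => ((i.1.1, i.2.1), (i.1.2, i.2.2))
    let D : Matrix ((Fin k × Fin l) × (Fin p × Fin q)) (Fin p × Fin q) ℂ :=
      Matrix.of fun i j => if i.2 = j then a i.1 else 0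
    have h3 := (h2.submatrix f).conjTranspose_mul_mul_same D
    have h4 := congrArg Φ h
    rw [map_add, map_smul, hunit] at h4
    rw [h4]
    suffices h5 : Φ (∑ i, ∑ j, (star (a i) * a j) • P i.1 j.1 ⊗ₜ[ℂ] Q i.2 j.2) = _ from
      h5 ▸ h3
    ext b c
    simp only [map_sum, map_smul, Matrix.sum_apply, Matrix.smul_apply, Matrix.mul_apply,
      Matrix.conjTranspose_apply, D, Matrix.of_apply, Fintype.sum_prod_type (α₁ := Fin k × Fin l),
      Finset.sum_mul, mul_ite, mul_zero, ite_mul, zero_mul, apply_ite star, star_zero,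
      Finset.sum_ite_eq', Finset.mem_univ, if_true]
    rw [Finset.sum_comm]
    refine Finset.sum_congr rfl fun i _ => Finset.sum_congr rfl fun j _ => ?_
    simp only [hΦ, f, LinearMap.comp_apply, TensorProduct.map_tmul, LinearEquiv.coe_coe,
      kroneckerLinearEquiv_tmul, Matrix.kroneckerMap_apply, Matrix.submatrix_apply,
      Matrix.of_apply, smul_eq_mul]
    ring
  have hherm : (Φ x).IsHermitian := by
    have := (h1 1 one_pos).isHermitian.sub (Matrix.isHermitian_one (n := Fin p × Fin q) (α := ℂ))
    simpa using this
  refine .of_dotProduct_mulVec_nonneg hherm fun v => ?_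
  have hlim : Filter.Tendsto (fun ε : ℝ => star v ⬝ᵥ ((Φ x + (ε : ℂ) • 1).mulVec v))
      (nhdsWithin 0 (Set.Ioi 0)) (nhds (star v ⬝ᵥ (Φ x).mulVec v)) := by
    have hc : Continuous fun ε : ℝ => star v ⬝ᵥ ((Φ x).mulVec v + (ε : ℂ) • v) := by
      have : Continuous fun ε : ℝ => star v ⬝ᵥ (Φ x).mulVec v + (ε : ℂ) * (star v ⬝ᵥ v) := by
        fun_prop
      simpa [dotProduct_add] using this
    have h5 := (hc.tendsto 0).mono_left (nhdsWithin_le_nhds (s := Set.Ioi 0))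
    simpa [Matrix.add_mulVec, Matrix.smul_mulVec] using h5
  refine ge_of_tendsto hlim ?_
  filter_upwards [self_mem_nhdsWithin] with ε hε
  exact (h1 ε hε).dotProduct_mulVec_nonneg v

end OperatorSystem

theorem kroneckerLinearEquiv_ofCoords {n m : ℕ} (x : Fin n → Fin n → Fin m → Fin m → ℂ) :
    kroneckerLinearEquiv (Fin n) (Fin n) (Fin m) (Fin m) ℂ (ofCoords x) =
      Matrix.of fun a b => x a.1 b.1 a.2 b.2 := by
  rw [eq_sum_single_kronecker (Matrix.of fun a b => x a.1 b.1 a.2 b.2)]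
  simp only [ofCoords, map_sum, map_smul, kroneckerLinearEquiv_tmul, Fintype.sum_prod_type,
    Matrix.of_apply]

/-! ### States on tensor products of the operator systems `𝒱_n` -/

/-- The elements `u_{ij} ⊗ v_{kl}`. -/
def genTensor {n m : ℕ} (a b : Fin n × Fin m) : (V n).carrier ⊗[ℂ] (V m).carrier :=
  V.gen a.1 b.1 ⊗ₜ[ℂ] V.gen a.2 b.2

theorem image_Bqa (n m : ℕ) : kroneckerLinearEquiv (Fin n) (Fin n) (Fin m) (Fin m) ℂ '' Bqa n m =
    functionalImage {x | (V n).MinPos (V m) x} ((V n).unit ⊗ₜ[ℂ] (V m).unit) genTensor := by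
  ext M
  constructor
  · rintro ⟨_, ⟨s, hs, rfl⟩, rfl⟩
    exact ⟨s, ⟨hs.map_unit, hs.map_pos⟩, kroneckerLinearEquiv_ofCoords _⟩
  · rintro ⟨s, hs, rfl⟩
    exact ⟨_, ⟨s, ⟨hs.map_unit, hs.map_pos⟩, rfl⟩, kroneckerLinearEquiv_ofCoords _⟩

theorem image_Bqmax (n m : ℕ) :
    kroneckerLinearEquiv (Fin n) (Fin n) (Fin m) (Fin m) ℂ '' Bqmax n m =
    functionalImage {x | (V n).MaxPos (V m) x} ((V n).unit ⊗ₜ[ℂ] (V m).unit) genTensor := by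
  ext M
  constructor
  · rintro ⟨_, ⟨s, hs, rfl⟩, rfl⟩
    exact ⟨s, ⟨hs.map_unit, hs.map_pos⟩, kroneckerLinearEquiv_ofCoords _⟩
  · rintro ⟨s, hs, rfl⟩
    exact ⟨_, ⟨s, ⟨hs.map_unit, hs.map_pos⟩, rfl⟩, kroneckerLinearEquiv_ofCoords _⟩

/-- The maximal cone is the smaller one, so it admits more states. -/
theorem functionalImage_minPos_subset (n m : ℕ) :
    functionalImage {x | (V n).MinPos (V m) x} ((V n).unit ⊗ₜ[ℂ] (V m).unit) genTensor ⊆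
    functionalImage {x | (V n).MaxPos (V m) x} ((V n).unit ⊗ₜ[ℂ] (V m).unit) genTensor := by
  rintro _ ⟨s, hs, rfl⟩
  exact ⟨s, ⟨hs.map_unit, fun x hx => hs.map_pos x hx.minPos⟩, rfl⟩

/-! ### Boundedness of states and functoriality of the two cones -/

namespace OperatorSystem

variable {A B : Type*} [CStarAlgebra A] [CStarAlgebra B]

theorem maxPos_tmul {S : OperatorSystem A} {T : OperatorSystem B} {x : S.carrier} {y : T.carrier}
    (hx : S.Pos x) (hy : T.Pos y) : S.MaxPos T (x ⊗ₜ[ℂ] y) := by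
  obtain ⟨a, ha⟩ := hx
  obtain ⟨b, hb⟩ := hy
  have := maxPos_of_sum (S := S) (T := T) (ι := Unit) (κ := Unit) (P := Matrix.of fun _ _ => x)
    (Q := Matrix.of fun _ _ => y) (Y := Matrix.of fun _ _ => a) (Z := Matrix.of fun _ _ => b)
    (by ext; simpa [Matrix.mul_apply] using ha) (by ext; simpa [Matrix.mul_apply] using hb)
    (fun _ => 1)
  simpa [Fintype.sum_prod_type] using this

theorem pointwiseBounded_maxPos (S : OperatorSystem A) (T : OperatorSystem B) :
    PointwiseBounded {x | S.MaxPos T x} (S.unit ⊗ₜ[ℂ] T.unit) :=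
  (S.pointwiseBounded_tmul T).mono (by
    rintro _ ⟨P, Q, hP, hQ, rfl⟩
    exact maxPos_tmul hP hQ)

theorem pointwiseBounded_minPos (S : OperatorSystem A) (T : OperatorSystem B) :
    PointwiseBounded {x | S.MinPos T x} (S.unit ⊗ₜ[ℂ] T.unit) :=
  (S.pointwiseBounded_maxPos T).mono fun _ hx => MaxPos.minPos hx

/-- Unital completely positive maps between operator systems. -/
structure IsUCPMap (S : OperatorSystem A) (T : OperatorSystem B) (α : S.carrier →ₗ[ℂ] T.carrier) :
    Prop where
  map_unit : α S.unit = T.unit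
  map_pos : ∀ (k : ℕ) (X : Matrix (Fin k) (Fin k) S.carrier), S.MatPos X → T.MatPos (X.map α)

theorem IsUCPMap.minPos {S S' : OperatorSystem A} {T : OperatorSystem B}
    {α : S.carrier →ₗ[ℂ] S'.carrier} (hα : S.IsUCPMap S' α) {x : S.carrier ⊗[ℂ] T.carrier}
    (hx : S.MinPos T x) : S'.MinPos T (TensorProduct.map α LinearMap.id x) := by
  intro p q φ ψ hφ hψ
  have h := hx p q (φ ∘ₗ α) ψ ⟨by rw [LinearMap.comp_apply, hα.map_unit, hφ.map_unit],
    fun k X hX => hφ.map_pos k _ (hα.map_pos k X hX)⟩ hψ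
  rwa [← LinearMap.comp_apply (TensorProduct.map φ ψ), ← TensorProduct.map_comp,
    LinearMap.comp_id]

theorem IsUCPMap.maxPos {S S' : OperatorSystem A} {T : OperatorSystem B}
    {α : S.carrier →ₗ[ℂ] S'.carrier} (hα : S.IsUCPMap S' α) {x : S.carrier ⊗[ℂ] T.carrier}
    (hx : S.MaxPos T x) : S'.MaxPos T (TensorProduct.map α LinearMap.id x) := by
  intro ε hε
  obtain ⟨p, q, P, Q, a, hP, hQ, h⟩ := hx ε hε
  refine ⟨p, q, P.map α, Q, a, hα.map_pos p P hP, hQ, ?_⟩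
  have h1 := congrArg (TensorProduct.map α (LinearMap.id : T.carrier →ₗ[ℂ] T.carrier)) h
  simpa [hα.map_unit] using h1

end OperatorSystem

/-! ### The automorphisms `u_{ij} ↦ c u_{ij}` of `𝒰_nc(n)` -/

theorem smul_mem_unitary {R : Type*} [Ring R] [StarRing R] [Module ℂ R] [StarModule ℂ R]
    [IsScalarTower ℂ R R] [SMulCommClass ℂ R R] {c : ℂ} (hc : ‖c‖ = 1) {x : R}
    (hx : x ∈ unitary R) : c • x ∈ unitary R := by
  have h1 : star c * c = 1 := by rw [Complex.star_def, Complex.conj_mul', hc]; simp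
  refine Unitary.mem_iff.2 ⟨?_, ?_⟩
  · rw [star_smul, smul_mul_smul_comm, h1, one_smul, (Unitary.mem_iff.1 hx).1]
  · rw [star_smul, smul_mul_smul_comm, mul_comm, h1, one_smul, (Unitary.mem_iff.1 hx).2]

/-- The automorphism of `BoundedFamilies n` induced by `W ↦ c W`. -/
def rotateFamilies {n : ℕ} (c : ℂ) (hc : ‖c‖ = 1) : BoundedFamilies n →⋆ₐ[ℂ] BoundedFamilies n where
  toFun f := ⟨fun W => f.1 ⟨c • W.1, smul_mem_unitary hc W.2⟩, memℓp_infty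
    ⟨‖f‖, by rintro _ ⟨W, rfl⟩; exact lp.norm_apply_le_norm (by simp) f _⟩⟩
  map_one' := rfl
  map_mul' _ _ := rfl
  map_zero' := rfl
  map_add' _ _ := rfl
  commutes' _ := rfl
  map_star' _ := rfl

/-- The preimage of `𝒰_nc(n)` under this contractive ⋆-homomorphism is a closed ⋆-subalgebra
containing the coordinates. -/
theorem rotateFamilies_mem {n : ℕ} (c : ℂ) (hc : ‖c‖ = 1) (x : Unc n) :
    rotateFamilies c hc x.1 ∈ uncSubalgebra n := by
  have hcont : Continuous (rotateFamilies (n := n) c hc) :=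
    AddMonoidHomClass.continuous_of_bound _ 1 fun f => by
      rw [one_mul]
      exact lp.norm_le_of_forall_le (norm_nonneg f) fun W => lp.norm_apply_le_norm (by simp) f _
  have h : uncSubalgebra n ≤ (uncSubalgebra n).comap (rotateFamilies c hc) := by
    refine StarSubalgebra.topologicalClosure_minimal (StarAlgebra.adjoin_le ?_) ?_
    · rintro _ ⟨i, j, rfl⟩
      change rotateFamilies c hc (coordinate i j) ∈ uncSubalgebra n
      have : rotateFamilies c hc (coordinate i j) = c • coordinate i j := rfl
      rw [this]
      exact (uncSubalgebra n).smul_mem (gen i j).2 c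
    · exact (StarSubalgebra.isClosed_topologicalClosure _).preimage hcont
  exact h x.2

/-- The automorphism of `𝒰_nc(n)` with `u_{ij} ↦ c u_{ij}`. -/
def rotate {n : ℕ} (c : ℂ) (hc : ‖c‖ = 1) : Unc n →⋆ₐ[ℂ] Unc n :=
  StarAlgHom.codRestrict ((rotateFamilies c hc).comp (uncSubalgebra n).subtype) _
    (rotateFamilies_mem c hc)

theorem rotate_gen {n : ℕ} (c : ℂ) (hc : ‖c‖ = 1) (i j : Fin n) :
    rotate c hc (gen i j) = c • gen i j := rfl

theorem rotate_mem {n : ℕ} (c : ℂ) (hc : ‖c‖ = 1) (x : (V n).carrier) :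
    rotate c hc (x : Unc n) ∈ (V n).carrier := by
  obtain ⟨x, hx⟩ := x
  change rotate c hc x ∈ (V n).carrier
  induction hx using Submodule.span_induction with
  | mem x hx =>
    rcases hx with rfl | ⟨i, j, rfl | rfl⟩
    · rw [map_one]; exact (V n).one_mem
    · rw [Matrix.of_apply, rotate_gen]
      exact Submodule.smul_mem _ _ (V.gen i j).2
    · rw [map_star, Matrix.of_apply, rotate_gen]
      exact (V n).star_mem _ (Submodule.smul_mem _ _ (V.gen i j).2)
  | zero => rw [map_zero]; exact Submodule.zero_mem _
  | add x y _ _ hx hy => rw [map_add]; exact Submodule.add_mem _ hx hy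
  | smul a x _ hx => rw [map_smul]; exact Submodule.smul_mem _ _ hx

/-- The automorphism of `𝒱_n` with `u_{ij} ↦ c u_{ij}`. -/
def rotateV {n : ℕ} (c : ℂ) (hc : ‖c‖ = 1) : (V n).carrier →ₗ[ℂ] (V n).carrier :=
  ((rotate c hc).toAlgHom.toLinearMap ∘ₗ (V n).carrier.subtype).codRestrict _ (rotate_mem c hc)

/-- A restricted ⋆-homomorphism carries a factorisation `Y⋆ Y` to one entrywise. -/
theorem isUCPMap_rotateV {n : ℕ} (c : ℂ) (hc : ‖c‖ = 1) :
    (V n).IsUCPMap (V n) (rotateV c hc) := by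
  refine ⟨Subtype.ext (map_one (rotate c hc)), ?_⟩
  rintro k X ⟨Y, hY⟩
  refine ⟨Y.map (rotate c hc), ?_⟩
  ext i j : 2
  have h1 : rotate c hc (X i j : Unc n) = _ := congrArg (rotate c hc) (congrFun (congrFun hY i) j)
  have h2 : ((X.map (rotateV c hc)).map fun x => (x : Unc n)) i j = rotate c hc (X i j : Unc n) :=
    rfl
  rw [h2, h1]
  simp only [Matrix.mul_apply, Matrix.conjTranspose_apply, map_sum, map_mul, map_star,
    Matrix.map_apply]

theorem rotateV_gen {n : ℕ} (c : ℂ) (hc : ‖c‖ = 1) (i j : Fin n) :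
    rotateV c hc (V.gen i j) = c • V.gen i j :=
  Subtype.ext (rotate_gen c hc i j)

theorem map_rotateV_genTensor {n m : ℕ} (c : ℂ) (hc : ‖c‖ = 1) (a b : Fin n × Fin m) :
    TensorProduct.map (rotateV c hc) LinearMap.id (genTensor a b) = c • genTensor a b := by
  rw [genTensor, TensorProduct.map_tmul, rotateV_gen, TensorProduct.smul_tmul', LinearMap.id_apply]

/-- The functional `s ∘ α` is again normalised and positive. -/
theorem smul_mem_functionalImage {E : Type*} [AddCommGroup E] [Module ℂ E] {κ : Type*} {C : Set E}
    {e : E} {z : κ → κ → E} {c : ℂ} {α : E →ₗ[ℂ] E} (he : α e = e) (hC : ∀ x ∈ C, α x ∈ C)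
    (hz : ∀ a b, α (z a b) = c • z a b) {M : Matrix κ κ ℂ} (hM : M ∈ functionalImage C e z) :
    c • M ∈ functionalImage C e z := by
  obtain ⟨s, hs, rfl⟩ := hM
  refine ⟨s ∘ₗ α, ⟨?_, fun x hx => hs.map_pos _ (hC x hx)⟩, ?_⟩
  · rw [LinearMap.comp_apply, he, hs.map_unit]
  · ext a b
    simp [hz]

theorem map_rotateV_unit {n m : ℕ} (c : ℂ) (hc : ‖c‖ = 1) :
    TensorProduct.map (rotateV c hc) LinearMap.id ((V n).unit ⊗ₜ[ℂ] (V m).unit) =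
      (V n).unit ⊗ₜ[ℂ] (V m).unit := by
  rw [TensorProduct.map_tmul, (isUCPMap_rotateV c hc).map_unit, LinearMap.id_apply]

/-! ### Product states given by scalar unitaries -/

/-- The vector functional `x ↦ ⟨π(x) ξ, ξ⟩` on an operator system, with values in `M_1`. -/
def vectorFunctional {A H : Type*} [CStarAlgebra A] [NormedAddCommGroup H] [InnerProductSpace ℂ H]
    [CompleteSpace H] (S : OperatorSystem A) (π : A →⋆ₐ[ℂ] (H →L[ℂ] H)) (ξ : H) :
    S.carrier →ₗ[ℂ] Matrix (Fin 1) (Fin 1) ℂ where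
  toFun x := Matrix.of fun _ _ => inner ℂ ξ (π x ξ)
  map_add' x y := by
    ext
    simp
  map_smul' c x := by
    ext
    simp

/-- When `X = Y⋆ Y`, the amplified matrix is the Gram matrix of the vectors `(π(Y c b) ξ)_c`. -/
theorem isUCP_vectorFunctional {A H : Type*} [CStarAlgebra A] [NormedAddCommGroup H]
    [InnerProductSpace ℂ H] [CompleteSpace H] (S : OperatorSystem A) (π : A →⋆ₐ[ℂ] (H →L[ℂ] H))
    {ξ : H} (hξ : ‖ξ‖ = 1) : S.IsUCP (vectorFunctional S π ξ) := by
  refine ⟨?_, ?_⟩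
  · ext i j
    rw [Subsingleton.elim i j]
    simp [vectorFunctional, OperatorSystem.unit, hξ]
  · rintro k X ⟨Y, hY⟩
    have h := Matrix.posSemidef_gram ℂ fun b : Fin k × Fin 1 =>
      WithLp.toLp 2 fun c : Fin k => π (Y c b.1) ξ
    suffices h' : (Matrix.of fun a b : Fin k × Fin 1 =>
        vectorFunctional S π ξ (X a.1 b.1) a.2 b.2) = _ from h' ▸ h
    ext a b
    have h1 : (X a.1 b.1 : A) = ∑ c, star (Y c a.1) * Y c b.1 := by
      simpa [Matrix.mul_apply] using congrFun (congrFun hY a.1) b.1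
    simp only [Matrix.of_apply, Matrix.gram_apply, PiLp.inner_apply, vectorFunctional,
      LinearMap.coe_mk, AddHom.coe_mk, h1, map_sum, map_mul, map_star, sum_apply,
      inner_sum, mul_apply_eq_comp, ContinuousLinearMap.star_eq_adjoint,
      ContinuousLinearMap.adjoint_inner_right]

/-- Evaluation at a unitary. -/
def evalUnitary {n : ℕ} (W : UnitaryMatrices n) : Unc n →⋆ₐ[ℂ] (Ell2 →L[ℂ] Ell2) where
  toFun f := f.1 W
  map_one' := rfl
  map_mul' _ _ := rfl
  map_zero' := rfl
  map_add' _ _ := rfl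
  commutes' _ := rfl
  map_star' _ := rfl

theorem map_algebraMap_mem_unitary {n : ℕ} {R : Type*} [Ring R] [StarRing R] [Algebra ℂ R]
    [StarModule ℂ R] {U : Matrix (Fin n) (Fin n) ℂ} (hU : U ∈ unitary (Matrix (Fin n) (Fin n) ℂ)) :
    U.map (algebraMap ℂ R) ∈ unitary (Matrix (Fin n) (Fin n) R) := by
  have h : star (U.map (algebraMap ℂ R)) = (star U).map (algebraMap ℂ R) := by
    ext i j
    exact (algebraMap_star_comm _).symm
  refine Unitary.mem_iff.2 ⟨?_, ?_⟩
  · rw [h, ← Matrix.map_mul, (Unitary.mem_iff.1 hU).1, Matrix.map_one _ (map_zero _) (map_one _)]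
  · rw [h, ← Matrix.map_mul, (Unitary.mem_iff.1 hU).2, Matrix.map_one _ (map_zero _) (map_one _)]

/-- Let the entries of `U` and `W` act as scalars on `ℓ²`. Vector states at these evaluations are
ucp into `M_1`, so their product is positive by the case `p = q = 1` of `MinPos`. -/
theorem kronecker_mem_functionalImage_minPos {n m : ℕ} {U : Matrix (Fin n) (Fin n) ℂ}
    (hU : U ∈ unitary (Matrix (Fin n) (Fin n) ℂ)) {W : Matrix (Fin m) (Fin m) ℂ}
    (hW : W ∈ unitary (Matrix (Fin m) (Fin m) ℂ)) :
    Matrix.kroneckerMap (· * ·) U W ∈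
      functionalImage {x | (V n).MinPos (V m) x} ((V n).unit ⊗ₜ[ℂ] (V m).unit) genTensor := by
  obtain ⟨ξ, hξ⟩ := exists_norm_eq Ell2 zero_le_one
  have h1 := isUCP_vectorFunctional (V n)
    (evalUnitary ⟨_, map_algebraMap_mem_unitary (R := Ell2 →L[ℂ] Ell2) hU⟩) hξ
  have h2 := isUCP_vectorFunctional (V m)
    (evalUnitary ⟨_, map_algebraMap_mem_unitary (R := Ell2 →L[ℂ] Ell2) hW⟩) hξ
  set φ := vectorFunctional (V n)
    (evalUnitary ⟨_, map_algebraMap_mem_unitary (R := Ell2 →L[ℂ] Ell2) hU⟩) ξ with hφ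
  set ψ := vectorFunctional (V m)
    (evalUnitary ⟨_, map_algebraMap_mem_unitary (R := Ell2 →L[ℂ] Ell2) hW⟩) ξ with hψ
  refine ⟨Matrix.entryLinearMap ℂ ℂ ((0 : Fin 1), (0 : Fin 1)) ((0 : Fin 1), (0 : Fin 1)) ∘ₗ
    (kroneckerLinearEquiv (Fin 1) (Fin 1) (Fin 1) (Fin 1) ℂ).toLinearMap ∘ₗ TensorProduct.map φ ψ,
    ⟨?_, fun x hx => ?_⟩, ?_⟩
  · simp [h1.map_unit, h2.map_unit]
  · exact (hx 1 1 φ ψ h1 h2).diag_nonneg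
  · have hentry : ∀ {k : ℕ} {X : Matrix (Fin k) (Fin k) ℂ}
        (hX : X ∈ unitary (Matrix (Fin k) (Fin k) ℂ)) (i j : Fin k),
        vectorFunctional (V k)
          (evalUnitary ⟨_, map_algebraMap_mem_unitary (R := Ell2 →L[ℂ] Ell2) hX⟩) ξ
            (V.gen i j) 0 0 = X i j := by
      intro k X hX i j
      change inner ℂ ξ ((algebraMap ℂ (Ell2 →L[ℂ] Ell2) (X i j)) ξ) = X i j
      simp [Algebra.algebraMap_eq_smul_one, hξ]
    ext a b
    simp only [genTensor, Matrix.kroneckerMap_apply, Matrix.of_apply, LinearMap.comp_apply,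
      TensorProduct.map_tmul, LinearEquiv.coe_coe, kroneckerLinearEquiv_tmul,
      Matrix.entryLinearMap_apply]
    rw [hφ, hψ, hentry hU, hentry hW]

/-! ### The norm of a matrix given by a state on `𝒱_n ⊗_max 𝒱_m` -/

/-- Vanishing imaginary parts at `c = 1` and `c = i` force `b = star a`; then `c = star a / ‖a‖`
gives `N - 2‖a‖ ≥ 0`. -/
theorem two_mul_norm_le_of_phase {N : ℝ} {a b : ℂ}
    (h : ∀ c : ℂ, ‖c‖ = 1 → 0 ≤ (N : ℂ) - c * a - star c * b) : 2 * ‖a‖ ≤ N := by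
  have h1 := (Complex.le_def.1 (h 1 (by simp))).2
  have h2 := (Complex.le_def.1 (h Complex.I (by simp))).2
  have hb : b = star a := by
    simp at h1 h2
    apply Complex.ext
    · simp; linarith
    · simp; linarith
  by_cases ha : a = 0
  · have h3 := (Complex.le_def.1 (h 1 (by simp))).1
    simp [hb, ha] at h3
    simpa [ha] using h3
  have ha' : (‖a‖ : ℂ) ≠ 0 := by exact_mod_cast norm_ne_zero_iff.2 ha
  have h3 := (Complex.le_def.1 (h (star a / ‖a‖) (by simp [norm_ne_zero_iff.2 ha]))).1
  have h4 : star a / ‖a‖ * a = ‖a‖ := by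
    rw [div_mul_eq_mul_div, Complex.star_def, Complex.conj_mul', sq, mul_div_assoc,
      div_self ha', mul_one]
  have h5 : star (star a / (‖a‖ : ℂ)) * b = ‖a‖ := by
    rw [hb, ← star_mul', h4, Complex.star_def, Complex.conj_ofReal]
  rw [h4, h5] at h3
  simp at h3
  linarith

theorem sum_star_gen_mul_gen {n : ℕ} (i j : Fin n) :
    ∑ k, star (gen k i) * gen k j = (if i = j then 1 else 0 : Unc n) := by
  have h : ∀ W : UnitaryMatrices n, (∑ k, star (W.1 k i) * W.1 k j) =
      (if i = j then 1 else 0 : Ell2 →L[ℂ] Ell2) := by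
    intro W
    simpa [Matrix.mul_apply, Matrix.star_apply, Matrix.one_apply] using
      congrFun (congrFun (Unitary.mem_iff.1 W.2).1 i) j
  apply Subtype.ext
  apply lp.ext
  funext W
  have h1 := map_sum (evalUnitary W) (fun k => star (gen k i) * gen k j) Finset.univ
  refine h1.trans ((h W).trans ?_)
  split_ifs <;> rfl

/-- The elements `u_{ji}⋆` of `𝒱_n`. -/
def V.starGen {n : ℕ} (i j : Fin n) : (V n).carrier :=
  ⟨star (UnitaryCorrelation.gen j i), (V n).star_mem _ (V.gen j i).2⟩

/-- The positive matrix `[[1, u], [u⋆, 1]]` over `𝒱_n`. -/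
def unitaryBlock (n : ℕ) : Matrix (Fin n ⊕ Fin n) (Fin n ⊕ Fin n) (V n).carrier :=
  Matrix.fromBlocks (Matrix.diagonal fun _ => (V n).unit) (Matrix.of V.gen)
    (Matrix.of V.starGen)
    (Matrix.diagonal fun _ => (V n).unit)

/-- The lower right block of the product is `u⋆u = 1`. -/
theorem unitaryBlock_eq (n : ℕ) : ((unitaryBlock n).map fun x => (x : Unc n)) =
    (Matrix.fromBlocks 1 (Matrix.of gen) 0 0).conjTranspose *
      Matrix.fromBlocks 1 (Matrix.of gen) 0 0 := by
  rw [Matrix.fromBlocks_conjTranspose, Matrix.fromBlocks_multiply, unitaryBlock,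
    Matrix.fromBlocks_map]
  congr 1
  · ext i j : 2
    by_cases h : i = j <;> simp [h, OperatorSystem.unit]
  · ext i j : 2
    simp [V.gen]
  · ext i j : 2
    simp [V.starGen]
  · ext i j : 2
    have := sum_star_gen_mul_gen i j
    simp only [Matrix.map_apply, Matrix.conjTranspose_zero, mul_zero, add_zero,
      Matrix.mul_apply, Matrix.conjTranspose_apply, Matrix.of_apply, this]
    by_cases h : i = j <;> simp [h, OperatorSystem.unit]

theorem sum_sum_prod_sum {ι κ M : Type*} [Fintype ι] [Fintype κ] [AddCommMonoid M]
    (f : (ι ⊕ ι) × (κ ⊕ κ) → M) (h1 : ∀ i k, f (.inl i, .inr k) = 0)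
    (h2 : ∀ i k, f (.inr i, .inl k) = 0) :
    ∑ p, f p = (∑ p : ι × κ, f (.inl p.1, .inl p.2)) + ∑ p : ι × κ, f (.inr p.1, .inr p.2) := by
  simp [Fintype.sum_prod_type, Fintype.sum_sum_type, h1, h2]

theorem sum_star_mul_ite {κ : Type*} [Fintype κ] [DecidableEq κ] (ξ : κ → ℂ) :
    ∑ p, ∑ q, star (ξ p) * ξ q * (if p = q then 1 else 0) =
      ((‖WithLp.toLp 2 ξ‖ ^ 2 : ℝ) : ℂ) := by
  rw [EuclideanSpace.norm_sq_eq]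
  push_cast
  refine Finset.sum_congr rfl fun p _ => ?_
  simp [Complex.conj_mul']

/-- The coefficients `(η, -ξ)` used to compress `[[1, u], [u⋆, 1]] ⊗ [[1, v], [v⋆, 1]]`. -/
def blockColumn {n m : ℕ} (η ξ : Fin n × Fin m → ℂ) :
    (Fin n ⊕ Fin n) × (Fin m ⊕ Fin m) → ℂ
  | (.inl i, .inl k) => η (i, k)
  | (.inr i, .inr k) => -ξ (i, k)
  | _ => 0

/-- Mixed indices carry coefficient `0`. The diagonal blocks give the two squared norms, and the
off-diagonal ones the cross terms with the sign from `-ξ`. -/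
theorem map_sum_blockColumn {n m : ℕ} {E F : Type*} [AddCommGroup E] [Module ℂ E] [AddCommGroup F]
    [Module ℂ F] {s : E ⊗[ℂ] F →ₗ[ℂ] ℂ} {e : E} {f : F} (hs : s (e ⊗ₜ[ℂ] f) = 1)
    (G G' : Matrix (Fin n) (Fin n) E) (K K' : Matrix (Fin m) (Fin m) F)
    (η ξ : Fin n × Fin m → ℂ) :
    s (∑ i, ∑ j, (star (blockColumn η ξ i) * blockColumn η ξ j) •
      (Matrix.fromBlocks (Matrix.diagonal fun _ => e) G G' (Matrix.diagonal fun _ => e) i.1 j.1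
        ⊗ₜ[ℂ] Matrix.fromBlocks (Matrix.diagonal fun _ => f) K K' (Matrix.diagonal fun _ => f)
          i.2 j.2)) =
    ((‖WithLp.toLp 2 η‖ ^ 2 : ℝ) : ℂ) + ((‖WithLp.toLp 2 ξ‖ ^ 2 : ℝ) : ℂ)
      - (∑ a, ∑ b, star (η a) * ξ b * s (G a.1 b.1 ⊗ₜ[ℂ] K a.2 b.2))
      - ∑ a, ∑ b, star (ξ a) * η b * s (G' a.1 b.1 ⊗ₜ[ℂ] K' a.2 b.2) := by
  have hdiag : ∀ p q : Fin n × Fin m,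
      s ((Matrix.diagonal fun _ => e : Matrix (Fin n) (Fin n) E) p.1 q.1 ⊗ₜ[ℂ]
        (Matrix.diagonal fun _ => f : Matrix (Fin m) (Fin m) F) p.2 q.2) =
        if p = q then 1 else 0 := by
    intro p q
    by_cases h1 : p.1 = q.1
    · by_cases h2 : p.2 = q.2
      · rw [if_pos (Prod.ext h1 h2), h1, h2, Matrix.diagonal_apply_eq, Matrix.diagonal_apply_eq, hs]
      · rw [if_neg fun h => h2 (congrArg Prod.snd h), Matrix.diagonal_apply_ne _ h2,
          TensorProduct.tmul_zero, map_zero]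
    · rw [if_neg fun h => h1 (congrArg Prod.fst h), Matrix.diagonal_apply_ne _ h1,
        TensorProduct.zero_tmul, map_zero]
  rw [← sum_star_mul_ite η, ← sum_star_mul_ite ξ, sum_sum_prod_sum]
  rotate_left
  · exact fun i k => Finset.sum_eq_zero fun j _ => by simp [blockColumn]
  · exact fun i k => Finset.sum_eq_zero fun j _ => by simp [blockColumn]
  have hinner : ∀ i : (Fin n ⊕ Fin n) × (Fin m ⊕ Fin m),
      ∑ j, (star (blockColumn η ξ i) * blockColumn η ξ j) •
        (Matrix.fromBlocks (Matrix.diagonal fun _ => e) G G' (Matrix.diagonal fun _ => e) i.1 j.1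
        ⊗ₜ[ℂ] Matrix.fromBlocks (Matrix.diagonal fun _ => f) K K' (Matrix.diagonal fun _ => f)
          i.2 j.2) = _ := fun i =>
    sum_sum_prod_sum _ (fun j l => by simp [blockColumn]) (fun j l => by simp [blockColumn])
  simp only [hinner]
  simp only [map_add, map_sum, map_smul, smul_eq_mul, Finset.sum_add_distrib,
    Matrix.fromBlocks_apply₁₁, Matrix.fromBlocks_apply₁₂, Matrix.fromBlocks_apply₂₁,
    Matrix.fromBlocks_apply₂₂, hdiag, blockColumn, star_neg, neg_mul, mul_neg, neg_neg,
    Finset.sum_neg_distrib]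
  ring

/-- Compressing the tensor of the two unitary blocks by `(η, -cξ)` and applying `s` bounds the form
by `‖η‖² + ‖ξ‖²`, once the phase `c` is optimised. -/
theorem norm_le_one_of_mem_functionalImage_maxPos {n m : ℕ}
    {M : Matrix (Fin n × Fin m) (Fin n × Fin m) ℂ}
    (hM : M ∈ functionalImage {x | (V n).MaxPos (V m) x} ((V n).unit ⊗ₜ[ℂ] (V m).unit) genTensor) :
    ‖M‖ ≤ 1 := by
  obtain ⟨s, hs, rfl⟩ := hM
  refine matrix_norm_le_one_of_form _ fun η ξ => ?_
  refine two_mul_norm_le_of_phase (b := ∑ a, ∑ b, star (ξ a) * η b *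
    s (Matrix.of V.starGen a.1 b.1 ⊗ₜ[ℂ] Matrix.of V.starGen a.2 b.2)) fun c hc => ?_
  have h1 := hs.map_pos _ (OperatorSystem.maxPos_of_sum (unitaryBlock_eq n) (unitaryBlock_eq m)
    (blockColumn η (c • ξ)))
  rw [unitaryBlock, unitaryBlock, map_sum_blockColumn hs.map_unit] at h1
  have h2 : ‖WithLp.toLp 2 (c • ξ)‖ = ‖WithLp.toLp 2 ξ‖ := by
    rw [WithLp.toLp_smul, norm_smul, hc, one_mul]
  rw [h2] at h1
  refine h1.trans_eq ?_
  push_cast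
  congr 1
  · congr 1
    rw [Finset.mul_sum]
    refine Finset.sum_congr rfl fun a _ => ?_
    rw [Finset.mul_sum]
    refine Finset.sum_congr rfl fun b _ => ?_
    simp only [Pi.smul_apply, smul_eq_mul, Matrix.of_apply, genTensor]
    ring
  · simp only [Pi.smul_apply, smul_eq_mul, star_mul', mul_assoc, ← Finset.mul_sum]

/-! ### Commuting pairs of unitary matrices over a star ring -/

/-- Commuting unitaries `U ∈ M_n(R)`, `W ∈ M_m(R)`; if `comm` holds, then all the entries of `U` and
`W` and their adjoints commute. -/
structure IsPair (comm : Prop) {R : Type*} [Ring R] [StarRing R] {n m : ℕ}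
    (U : Matrix (Fin n) (Fin n) R) (W : Matrix (Fin m) (Fin m) R) : Prop where
  left_unitary : U ∈ unitary (Matrix (Fin n) (Fin n) R)
  right_unitary : W ∈ unitary (Matrix (Fin m) (Fin m) R)
  commute : ∀ X ∈ entrySet U, ∀ Y ∈ entrySet W, X * Y = Y * X
  commute_all : comm → ∀ X ∈ entrySet U ∪ entrySet W, ∀ Y ∈ entrySet U ∪ entrySet W, X * Y = Y * X

theorem exists_entrySet_map {R S : Type*} [Ring R] [StarRing R] [Ring S] [StarRing S] {n : ℕ}
    (f : R →+* S) (hf : ∀ x, f (star x) = star (f x)) {U : Matrix (Fin n) (Fin n) R} {X : S}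
    (hX : X ∈ entrySet (U.map f)) : ∃ Y ∈ entrySet U, f Y = X := by
  rcases hX with rfl | ⟨i, j, rfl | rfl⟩
  · exact ⟨1, Or.inl rfl, map_one f⟩
  · exact ⟨U i j, Or.inr ⟨i, j, Or.inl rfl⟩, rfl⟩
  · exact ⟨star (U i j), Or.inr ⟨i, j, Or.inr rfl⟩, hf _⟩

theorem map_mem_unitary {R S : Type*} [Ring R] [StarRing R] [Ring S] [StarRing S] {n : ℕ}
    (f : R →+* S) (hf : ∀ x, f (star x) = star (f x)) {U : Matrix (Fin n) (Fin n) R}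
    (hU : U ∈ unitary (Matrix (Fin n) (Fin n) R)) :
    U.map f ∈ unitary (Matrix (Fin n) (Fin n) S) := by
  have h : star (U.map f) = (star U).map f := by
    ext i j
    exact (hf _).symm
  refine Unitary.mem_iff.2 ⟨?_, ?_⟩
  · rw [h, ← Matrix.map_mul, (Unitary.mem_iff.1 hU).1, Matrix.map_one _ (map_zero _) (map_one _)]
  · rw [h, ← Matrix.map_mul, (Unitary.mem_iff.1 hU).2, Matrix.map_one _ (map_zero _) (map_one _)]

theorem IsPair.map {comm : Prop} {R S : Type*} [Ring R] [StarRing R] [Ring S] [StarRing S]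
    {n m : ℕ} {U : Matrix (Fin n) (Fin n) R} {W : Matrix (Fin m) (Fin m) R} (h : IsPair comm U W)
    (f : R →+* S) (hf : ∀ x, f (star x) = star (f x)) : IsPair comm (U.map f) (W.map f) := by
  refine ⟨map_mem_unitary f hf h.left_unitary, map_mem_unitary f hf h.right_unitary, ?_, ?_⟩
  · intro X hX Y hY
    obtain ⟨X', hX', rfl⟩ := exists_entrySet_map f hf hX
    obtain ⟨Y', hY', rfl⟩ := exists_entrySet_map f hf hY
    rw [← map_mul, ← map_mul, h.commute X' hX' Y' hY']
  · intro hc X hX Y hY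
    have key : ∀ X ∈ entrySet (U.map f) ∪ entrySet (W.map f),
        ∃ Y ∈ entrySet U ∪ entrySet W, f Y = X := by
      rintro X (hX | hX)
      · obtain ⟨X', hX', rfl⟩ := exists_entrySet_map f hf hX
        exact ⟨X', Or.inl hX', rfl⟩
      · obtain ⟨X', hX', rfl⟩ := exists_entrySet_map f hf hX
        exact ⟨X', Or.inr hX', rfl⟩
    obtain ⟨X', hX', rfl⟩ := key X hX
    obtain ⟨Y', hY', rfl⟩ := key Y hY
    rw [← map_mul, ← map_mul, h.commute_all hc X' hX' Y' hY']

theorem map_mem_entrySet {R S : Type*} [Ring R] [StarRing R] [Ring S] [StarRing S] {n : ℕ}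
    (f : R →+* S) (hf : ∀ x, f (star x) = star (f x)) {U : Matrix (Fin n) (Fin n) R} {X : R}
    (hX : X ∈ entrySet U) : f X ∈ entrySet (U.map f) := by
  rcases hX with rfl | ⟨i, j, rfl | rfl⟩
  · exact Or.inl (map_one f)
  · exact Or.inr ⟨i, j, Or.inl rfl⟩
  · exact Or.inr ⟨i, j, Or.inr (hf _)⟩

/-- A jointly injective family of ⋆-homomorphisms detects the identities `U⋆U = 1 = UU⋆`. -/
theorem mem_unitary_of_forall_map {ι R : Type*} {S : ι → Type*} [Ring R] [StarRing R]
    [∀ i, Ring (S i)] [∀ i, StarRing (S i)] {n : ℕ} (f : ∀ i, R →+* S i)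
    (hf : ∀ i x, f i (star x) = star (f i x)) (hinj : ∀ x y, (∀ i, f i x = f i y) → x = y)
    {U : Matrix (Fin n) (Fin n) R}
    (h : ∀ i, U.map (f i) ∈ unitary (Matrix (Fin n) (Fin n) (S i))) :
    U ∈ unitary (Matrix (Fin n) (Fin n) R) := by
  have hext : ∀ X Y : Matrix (Fin n) (Fin n) R, (∀ i, X.map (f i) = Y.map (f i)) → X = Y :=
    fun X Y hXY => Matrix.ext fun a b => hinj _ _ fun i => congrFun (congrFun (hXY i) a) b
  have hs : ∀ i, (star U).map (f i) = star (U.map (f i)) := fun i => by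
    ext a b
    exact hf i _
  refine Unitary.mem_iff.2 ⟨hext _ _ fun i => ?_, hext _ _ fun i => ?_⟩
  · rw [Matrix.map_mul, Matrix.map_one _ (map_zero _) (map_one _), hs]
    exact (Unitary.mem_iff.1 (h i)).1
  · rw [Matrix.map_mul, Matrix.map_one _ (map_zero _) (map_one _), hs]
    exact (Unitary.mem_iff.1 (h i)).2

theorem IsPair.of_forall {comm : Prop} {ι R : Type*} {S : ι → Type*} [Ring R] [StarRing R]
    [∀ i, Ring (S i)] [∀ i, StarRing (S i)] {n m : ℕ} (f : ∀ i, R →+* S i)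
    (hf : ∀ i x, f i (star x) = star (f i x)) (hinj : ∀ x y, (∀ i, f i x = f i y) → x = y)
    {U : Matrix (Fin n) (Fin n) R} {W : Matrix (Fin m) (Fin m) R}
    (h : ∀ i, IsPair comm (U.map (f i)) (W.map (f i))) : IsPair comm U W := by
  refine ⟨mem_unitary_of_forall_map f hf hinj fun i => (h i).left_unitary,
    mem_unitary_of_forall_map f hf hinj fun i => (h i).right_unitary, ?_, ?_⟩
  · intro X hX Y hY
    refine hinj _ _ fun i => ?_
    rw [map_mul, map_mul]
    exact (h i).commute _ (map_mem_entrySet (f i) (hf i) hX) _ (map_mem_entrySet (f i) (hf i) hY)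
  · intro hc X hX Y hY
    refine hinj _ _ fun i => ?_
    rw [map_mul, map_mul]
    exact (h i).commute_all hc
      _ (hX.imp (map_mem_entrySet (f i) (hf i)) (map_mem_entrySet (f i) (hf i)))
      _ (hY.imp (map_mem_entrySet (f i) (hf i)) (map_mem_entrySet (f i) (hf i)))

theorem IsPair.of_commRing (comm : Prop) {R : Type*} [CommRing R] [StarRing R] {n m : ℕ}
    {U : Matrix (Fin n) (Fin n) R} {W : Matrix (Fin m) (Fin m) R}
    (hU : U ∈ unitary (Matrix (Fin n) (Fin n) R)) (hW : W ∈ unitary (Matrix (Fin m) (Fin m) R)) :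
    IsPair comm U W :=
  ⟨hU, hW, fun _ _ _ _ => mul_comm _ _, fun _ _ _ _ _ => mul_comm _ _⟩

theorem exists_entrySet_smul {R : Type*} [Ring R] [StarRing R] [Module ℂ R] [StarModule ℂ R]
    {n : ℕ} {c : ℂ} {U : Matrix (Fin n) (Fin n) R} {X : R} (hX : X ∈ entrySet (c • U)) :
    ∃ Y ∈ entrySet U, ∃ d : ℂ, X = d • Y := by
  rcases hX with rfl | ⟨i, j, rfl | rfl⟩
  · exact ⟨1, Or.inl rfl, 1, (one_smul ℂ _).symm⟩
  · exact ⟨U i j, Or.inr ⟨i, j, Or.inl rfl⟩, c, rfl⟩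
  · exact ⟨star (U i j), Or.inr ⟨i, j, Or.inr rfl⟩, star c, star_smul c _⟩

theorem IsPair.smul {comm : Prop} {R : Type*} [Ring R] [StarRing R] [Algebra ℂ R] [StarModule ℂ R]
    {n m : ℕ} {U : Matrix (Fin n) (Fin n) R} {W : Matrix (Fin m) (Fin m) R} (h : IsPair comm U W)
    {c : ℂ} (hc : ‖c‖ = 1) : IsPair comm (c • U) W := by
  refine ⟨smul_mem_unitary hc h.left_unitary, h.right_unitary, ?_, ?_⟩
  · intro X hX Y hY
    obtain ⟨X', hX', d, rfl⟩ := exists_entrySet_smul hX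
    rw [smul_mul_assoc, mul_smul_comm, h.commute X' hX' Y hY]
  · intro hcomm X hX Y hY
    have key : ∀ X ∈ entrySet (c • U) ∪ entrySet W,
        ∃ Y ∈ entrySet U ∪ entrySet W, ∃ d : ℂ, X = d • Y := by
      rintro X (hX | hX)
      · obtain ⟨X', hX', d, rfl⟩ := exists_entrySet_smul hX
        exact ⟨X', Or.inl hX', d, rfl⟩
      · exact ⟨X, Or.inr hX, 1, (one_smul ℂ _).symm⟩
    obtain ⟨X', hX', d, rfl⟩ := key X hX
    obtain ⟨Y', hY', e, rfl⟩ := key Y hY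
    rw [smul_mul_smul_comm, smul_mul_smul_comm, h.commute_all hcomm X' hX' Y' hY', mul_comm d e]

/-! ### Correlations of commuting pairs of operators -/

/-- The matrices `(⟨U_{ij} W_{kl} ψ, ψ⟩)` for commuting pairs on Hilbert spaces in `Type u`. -/
def vectorSet (comm : Prop) (n m : ℕ) : Set (Matrix (Fin n × Fin m) (Fin n × Fin m) ℂ) :=
  {M | ∃ (H : Type u) (_ : NormedAddCommGroup H) (_ : InnerProductSpace ℂ H) (_ : CompleteSpace H)
    (U : Matrix (Fin n) (Fin n) (H →L[ℂ] H)) (W : Matrix (Fin m) (Fin m) (H →L[ℂ] H)) (ψ : H),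
    IsPair comm U W ∧ ‖ψ‖ = 1 ∧ M = Matrix.of fun a b => inner ℂ ψ (U a.1 b.1 (W a.2 b.2 ψ))}

/-- The flag `False` makes `commute_all` vacuous, so `qc` and `loc` share one treatment. -/
theorem image_Bqc (n m : ℕ) :
    kroneckerLinearEquiv (Fin n) (Fin n) (Fin m) (Fin m) ℂ '' Bqc.{u} n m =
      vectorSet.{u} False n m := by
  ext M
  constructor
  · rintro ⟨_, ⟨H, _, _, _, U, W, ψ, h, hψ, rfl⟩, rfl⟩
    exact ⟨H, _, _, _, U, W, ψ, ⟨h.left_unitary, h.right_unitary, h.commute, False.elim⟩, hψ,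
      kroneckerLinearEquiv_ofCoords _⟩
  · rintro ⟨H, _, _, _, U, W, ψ, h, hψ, rfl⟩
    exact ⟨_, ⟨H, _, _, _, U, W, ψ, ⟨h.left_unitary, h.right_unitary, h.commute⟩, hψ, rfl⟩,
      kroneckerLinearEquiv_ofCoords _⟩

theorem star_mem_entrySet {R : Type*} [Ring R] [StarRing R] {n : ℕ} {U : Matrix (Fin n) (Fin n) R}
    {X : R} (hX : X ∈ entrySet U) : star X ∈ entrySet U := by
  rcases hX with rfl | ⟨i, j, rfl | rfl⟩
  · exact Or.inl (star_one _)
  · exact Or.inr ⟨i, j, Or.inr rfl⟩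
  · exact Or.inr ⟨i, j, Or.inl (star_star _)⟩

/-- Commutativity means `S ⊆ S'`, hence `S'' ⊆ S'`; the closure lies in `S''`, whose elements
commute with those of `S'`. -/
theorem commute_topologicalClosure_adjoin {A : Type*} [CStarAlgebra A] {S : Set A}
    (hstar : ∀ x ∈ S, star x ∈ S) (hS : ∀ x ∈ S, ∀ y ∈ S, x * y = y * x) :
    ∀ a ∈ (StarAlgebra.adjoin ℂ S).topologicalClosure,
      ∀ b ∈ (StarAlgebra.adjoin ℂ S).topologicalClosure, a * b = b * a := by
  have h1 : S ⊆ StarSubalgebra.centralizer ℂ S := fun x hx => by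
    refine StarSubalgebra.mem_centralizer_iff ℂ |>.2 fun y hy => ?_
    exact ⟨hS y hy x hx, hS _ (hstar y hy) x hx⟩
  have h2 := StarSubalgebra.topologicalClosure_adjoin_le_centralizer_centralizer ℂ S
  intro a ha b hb
  have ha' := (StarSubalgebra.mem_centralizer_iff ℂ).1 (h2 ha)
  have hb' : b ∈ StarSubalgebra.centralizer ℂ S :=
    (StarSubalgebra.mem_centralizer_iff ℂ).2 fun y hy =>
      (StarSubalgebra.mem_centralizer_iff ℂ).1 (h2 hb) y (h1 hy)
  exact (ha' b hb').1.symm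

theorem image_Bloc (n m : ℕ) :
    kroneckerLinearEquiv (Fin n) (Fin n) (Fin m) (Fin m) ℂ '' Bloc.{u} n m =
      vectorSet.{u} True n m := by
  ext M
  constructor
  · rintro ⟨_, ⟨H, _, _, _, U, W, ψ, h, hcomm, hψ, rfl⟩, rfl⟩
    have hsub : ∀ X ∈ entrySet U ∪ entrySet W,
        X ∈ (StarAlgebra.adjoin ℂ (entrySet U ∪ entrySet W)).topologicalClosure := fun X hX =>
      StarSubalgebra.le_topologicalClosure _ (StarAlgebra.subset_adjoin ℂ _ hX)
    exact ⟨H, _, _, _, U, W, ψ, ⟨h.left_unitary, h.right_unitary, h.commute,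
      fun _ X hX Y hY => hcomm X (hsub X hX) Y (hsub Y hY)⟩, hψ, kroneckerLinearEquiv_ofCoords _⟩
  · rintro ⟨H, _, _, _, U, W, ψ, h, hψ, rfl⟩
    exact ⟨_, ⟨H, _, _, _, U, W, ψ, ⟨h.left_unitary, h.right_unitary, h.commute⟩,
      commute_topologicalClosure_adjoin
        (fun X hX => hX.imp star_mem_entrySet star_mem_entrySet) (h.commute_all trivial),
      hψ, rfl⟩, kroneckerLinearEquiv_ofCoords _⟩

theorem inner_self_eq_ofReal {H : Type*} [NormedAddCommGroup H] [InnerProductSpace ℂ H] (x : H) :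
    inner ℂ x x = ((‖x‖ ^ 2 : ℝ) : ℂ) := by
  rw [inner_self_eq_norm_sq_to_K]
  simp

/-! ### States on C*-algebras -/

/-- The positive cone of a C*-algebra. -/
def starMulSelfSet (A : Type*) [CStarAlgebra A] : Set A := {x | ∃ y, x = star y * y}

theorem pointwiseBounded_starMulSelfSet (A : Type*) [CStarAlgebra A] :
    PointwiseBounded (starMulSelfSet A) (1 : A) := by
  let _ := CStarAlgebra.spectralOrder A
  let _ := CStarAlgebra.spectralOrderedRing A
  have hset : starMulSelfSet A = {a : A | 0 ≤ a} := by
    ext a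
    exact CStarAlgebra.nonneg_iff_eq_star_mul_self.symm
  refine .of_span (G := starMulSelfSet A) (hset ▸ CStarAlgebra.span_nonneg) ?_
  intro x hx
  refine ⟨‖x‖, fun s hs => ?_⟩
  have h0 := hs.map_pos x hx
  have hsa : IsSelfAdjoint x := by
    obtain ⟨y, rfl⟩ := hx
    exact .star_mul_self y
  have h1 := hs.map_pos _ (exists_smul_one_sub_eq hsa)
  rw [map_sub, map_smul, hs.map_unit, smul_eq_mul, mul_one, sub_nonneg] at h1
  rw [Complex.le_def] at h0 h1
  have h2 : s x = ((s x).re : ℂ) := Complex.ext rfl (by simpa using h0.2.symm)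
  rw [h2, Complex.norm_real, Real.norm_of_nonneg h0.1]
  exact h1.1

/-- GNS, with `ψ` the class of `1`; the space stays in the universe of `A`. -/
theorem exists_representation {A : Type u} [CStarAlgebra A] {s : A →ₗ[ℂ] ℂ}
    (hs : IsNormalizedOn (starMulSelfSet A) 1 s) :
    ∃ (H : Type u) (_ : NormedAddCommGroup H) (_ : InnerProductSpace ℂ H) (_ : CompleteSpace H)
      (π : A →⋆ₐ[ℂ] (H →L[ℂ] H)) (ψ : H), ‖ψ‖ = 1 ∧ ∀ a, inner ℂ ψ (π a ψ) = s a := by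
  let _ := CStarAlgebra.spectralOrder A
  let _ := CStarAlgebra.spectralOrderedRing A
  let f : A →ₚ[ℂ] ℂ := PositiveLinearMap.mk₀ s fun x hx =>
    hs.map_pos x (CStarAlgebra.nonneg_iff_eq_star_mul_self.1 hx)
  have hinner : ∀ a, inner ℂ ((f.toPreGNS 1 : f.PreGNS) : f.GNS)
      (f.gnsStarAlgHom a ((f.toPreGNS 1 : f.PreGNS) : f.GNS)) = s a := by
    intro a
    have h1 : f.gnsStarAlgHom a ((f.toPreGNS 1 : f.PreGNS) : f.GNS) =
        ((f.leftMulMapPreGNS a (f.toPreGNS 1) : f.PreGNS) : f.GNS) :=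
      PositiveLinearMap.gnsNonUnitalStarAlgHom_apply_coe f
    rw [h1, UniformSpace.Completion.inner_coe, PositiveLinearMap.preGNS_inner_def]
    simp
    rfl
  refine ⟨f.GNS, inferInstance, inferInstance, inferInstance, f.gnsStarAlgHom,
    ((f.toPreGNS 1 : f.PreGNS) : f.GNS), ?_, hinner⟩
  have h1 := hinner 1
  rw [map_one f.gnsStarAlgHom, hs.map_unit, one_apply_eq_self, inner_self_eq_ofReal] at h1
  have h2 : ‖((f.toPreGNS 1 : f.PreGNS) : f.GNS)‖ ^ 2 = 1 := Complex.ofReal_eq_one.1 h1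
  exact (pow_eq_one_iff_of_nonneg (norm_nonneg _) two_ne_zero).1 h2

theorem functionalImage_subset_vectorSet {comm : Prop} {n m : ℕ} {A : Type u} [CStarAlgebra A]
    {U : Matrix (Fin n) (Fin n) A} {W : Matrix (Fin m) (Fin m) A} (h : IsPair comm U W) :
    functionalImage (starMulSelfSet A) 1 (fun a b => U a.1 b.1 * W a.2 b.2) ⊆
      vectorSet.{u} comm n m := by
  rintro _ ⟨s, hs, rfl⟩
  obtain ⟨H, _, _, _, π, ψ, hψ, hπ⟩ := exists_representation hs
  refine ⟨H, _, _, _, _, _, ψ, h.map (π : A →+* (H →L[ℂ] H)) (fun x => map_star π x), hψ, ?_⟩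
  ext a b
  rw [Matrix.of_apply, Matrix.of_apply, ← hπ, map_mul]
  rfl

theorem inner_mem_functionalImage {A H : Type*} [CStarAlgebra A] [NormedAddCommGroup H]
    [InnerProductSpace ℂ H] [CompleteSpace H] (π : A →⋆ₐ[ℂ] (H →L[ℂ] H)) {ψ : H} (hψ : ‖ψ‖ = 1)
    {κ : Type*} (z : κ → κ → A) :
    (Matrix.of fun a b => inner ℂ ψ (π (z a b) ψ) : Matrix κ κ ℂ) ∈
      functionalImage (starMulSelfSet A) 1 z := by
  refine ⟨{ toFun := fun a => inner ℂ ψ (π a ψ)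
            map_add' := fun a b => by rw [map_add, add_apply, inner_add_right]
            map_smul' := fun c a => by
              rw [map_smul, smul_apply, inner_smul_right]; rfl }, ⟨?_, ?_⟩, rfl⟩
  · change inner ℂ ψ (π 1 ψ) = 1
    rw [map_one, one_apply_eq_self, inner_self_eq_norm_sq_to_K, hψ]
    simp
  · rintro _ ⟨a, rfl⟩
    change 0 ≤ inner ℂ ψ (π (star a * a) ψ)
    rw [map_mul, map_star, mul_apply_eq_comp, ContinuousLinearMap.star_eq_adjoint,
      ContinuousLinearMap.adjoint_inner_right, inner_self_eq_ofReal]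
    exact Complex.zero_le_real.2 (sq_nonneg _)

/-! ### Direct sums of commuting pairs -/

section Family

variable {ι : Type*} {H : ι → Type*} [∀ i, NormedAddCommGroup (H i)]
  [∀ i, InnerProductSpace ℂ (H i)] [∀ i, CompleteSpace (H i)] [∀ i, Nontrivial (H i)]

instance instCStarAlgebraFamily : CStarAlgebra (lp (fun i => H i →L[ℂ] H i) ∞) where
  toCompleteSpace := inferInstance

/-- A family of unitary matrices, as a matrix over the C*-algebra of bounded families. -/
def familyMatrix {n : ℕ} (U : ∀ i, Matrix (Fin n) (Fin n) (H i →L[ℂ] H i))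
    (hU : ∀ i, U i ∈ unitary (Matrix (Fin n) (Fin n) (H i →L[ℂ] H i))) :
    Matrix (Fin n) (Fin n) (lp (fun i => H i →L[ℂ] H i) ∞) :=
  Matrix.of fun a b => ⟨fun i => U i a b,
    memℓp_infty ⟨1, by rintro _ ⟨i, rfl⟩; exact norm_entry_le_one (hU i) a b⟩⟩

/-- The `i`-th component of a bounded family. -/
def familyEval (i : ι) : lp (fun i => H i →L[ℂ] H i) ∞ →⋆ₐ[ℂ] (H i →L[ℂ] H i) where
  toFun f := f.1 i
  map_one' := rfl
  map_mul' _ _ := rfl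
  map_zero' := rfl
  map_add' _ _ := rfl
  commutes' _ := rfl
  map_star' _ := rfl

theorem family_ext {f g : lp (fun i => H i →L[ℂ] H i) ∞}
    (h : ∀ i, familyEval (H := H) i f = familyEval (H := H) i g) : f = g := lp.ext (funext h)

theorem isPair_familyMatrix {comm : Prop} {n m : ℕ}
    {U : ∀ i, Matrix (Fin n) (Fin n) (H i →L[ℂ] H i)}
    {W : ∀ i, Matrix (Fin m) (Fin m) (H i →L[ℂ] H i)} (h : ∀ i, IsPair comm (U i) (W i)) :
    IsPair comm (familyMatrix U fun i => (h i).left_unitary)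
      (familyMatrix W fun i => (h i).right_unitary) :=
  .of_forall (fun i => (familyEval (H := H) i).toAlgHom.toRingHom)
    (fun i x => map_star (familyEval (H := H) i) x) (fun _ _ => family_ext) fun i => h i

end Family

/-- Choose one pair for each correlation and take their direct sum, indexed by the correlation set
itself. Each correlation is a vector state on its own component; conversely, GNS turns any state of
the sum into a correlation of the same kind. -/
theorem exists_vectorSet_eq_functionalImage (comm : Prop) (n m : ℕ) :
    ∃ (A : Type u) (_ : CStarAlgebra A) (z : Fin n × Fin m → Fin n × Fin m → A),
      vectorSet.{u} comm n m = functionalImage (starMulSelfSet A) 1 z := by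
  choose H i₁ i₂ i₃ U W ψ hpair hψ hM using fun M : vectorSet.{u} comm n m => M.2
  have hnt : ∀ M, Nontrivial (H M) := fun M =>
    ⟨ψ M, 0, fun h => by simpa [h] using hψ M⟩
  refine ⟨lp (fun M => H M →L[ℂ] H M) ∞, inferInstance, _, Set.Subset.antisymm ?_
    (functionalImage_subset_vectorSet (isPair_familyMatrix hpair))⟩
  intro M hM'
  have h := inner_mem_functionalImage (familyEval (H := H) ⟨M, hM'⟩) (hψ ⟨M, hM'⟩)
    fun a b : Fin n × Fin m => familyMatrix U (fun i => (hpair i).left_unitary) a.1 b.1 *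
      familyMatrix W (fun i => (hpair i).right_unitary) a.2 b.2
  rw [show M = _ from hM ⟨M, hM'⟩]
  simp only [map_mul] at h
  exact h

theorem isClosed_vectorSet (comm : Prop) (n m : ℕ) : IsClosed (vectorSet.{u} comm n m) := by
  obtain ⟨A, _, z, h⟩ := exists_vectorSet_eq_functionalImage.{u} comm n m
  exact h ▸ isClosed_functionalImage (pointwiseBounded_starMulSelfSet A) z

theorem convex_vectorSet (comm : Prop) (n m : ℕ) : Convex ℝ (vectorSet.{u} comm n m) := by
  obtain ⟨A, _, z, h⟩ := exists_vectorSet_eq_functionalImage.{u} comm n m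
  exact h ▸ convex_functionalImage _ _ z

theorem smul_mem_vectorSet {comm : Prop} {n m : ℕ}
    {M : Matrix (Fin n × Fin m) (Fin n × Fin m) ℂ} (hM : M ∈ vectorSet.{u} comm n m) {c : ℂ}
    (hc : ‖c‖ = 1) : c • M ∈ vectorSet.{u} comm n m := by
  obtain ⟨H, _, _, _, U, W, ψ, h, hψ, rfl⟩ := hM
  refine ⟨H, _, _, _, _, _, ψ, h.smul hc, hψ, ?_⟩
  ext a b
  simp

/-- Scalars act on a one-dimensional Hilbert space, where everything commutes; `PUnit` places it in
universe `u`. -/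
theorem kronecker_mem_vectorSet (comm : Prop) {n m : ℕ} {U : Matrix (Fin n) (Fin n) ℂ}
    (hU : U ∈ unitary (Matrix (Fin n) (Fin n) ℂ)) {W : Matrix (Fin m) (Fin m) ℂ}
    (hW : W ∈ unitary (Matrix (Fin m) (Fin m) ℂ)) :
    Matrix.kroneckerMap (· * ·) U W ∈ vectorSet.{u} comm n m := by
  obtain ⟨ψ, hψ⟩ := exists_norm_eq (EuclideanSpace ℂ PUnit.{u + 1}) zero_le_one
  refine ⟨EuclideanSpace ℂ PUnit.{u + 1}, inferInstance, inferInstance, inferInstance, _, _, ψ,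
    (IsPair.of_commRing comm hU hW).map (algebraMap ℂ _) algebraMap_star_comm, hψ, ?_⟩
  ext a b
  simp [Algebra.algebraMap_eq_smul_one, -inner_self_eq_norm_sq_to_K,
    inner_self_eq_ofReal, hψ, mul_comm]

/-! ### The norm of a correlation matrix -/

/-- `X` acts isometrically on `H^n`, here on the vector `ξ ⊗ ψ`. -/
theorem sum_norm_sq_unitary_apply {H : Type*} [NormedAddCommGroup H] [InnerProductSpace ℂ H]
    [CompleteSpace H] {n : ℕ} {X : Matrix (Fin n) (Fin n) (H →L[ℂ] H)}
    (hX : X ∈ unitary (Matrix (Fin n) (Fin n) (H →L[ℂ] H))) (ξ : Fin n → ℂ) {ψ : H}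
    (hψ : ‖ψ‖ = 1) : ∑ k, ‖∑ l, ξ l • X k l ψ‖ ^ 2 = ∑ l, ‖ξ l‖ ^ 2 := by
  have h1 : ∀ l l', ∑ k, inner ℂ (X k l ψ) (X k l' ψ) = if l = l' then (1 : ℂ) else 0 := by
    intro l l'
    have h2 := congrArg (fun T : H →L[ℂ] H => inner ℂ ψ (T ψ))
      (congrFun (congrFun (Unitary.mem_iff.1 hX).1 l) l')
    simp only [Matrix.mul_apply, Matrix.star_apply, sum_apply, inner_sum, mul_apply_eq_comp,
      ContinuousLinearMap.star_eq_adjoint, ContinuousLinearMap.adjoint_inner_right] at h2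
    rw [h2]
    by_cases hl : l = l' <;> simp [Matrix.one_apply, hl, hψ]
  have h3 : ((∑ k, ‖∑ l, ξ l • X k l ψ‖ ^ 2 : ℝ) : ℂ) = ((∑ l, ‖ξ l‖ ^ 2 : ℝ) : ℂ) := by
    have h5 : ∀ k, ((‖∑ l, ξ l • X k l ψ‖ ^ 2 : ℝ) : ℂ) =
        ∑ l, ∑ l', star (ξ l) * ξ l' * inner ℂ (X k l ψ) (X k l' ψ) := by
      intro k
      rw [← inner_self_eq_ofReal, sum_inner]
      refine Finset.sum_congr rfl fun l _ => ?_
      rw [inner_sum]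
      refine Finset.sum_congr rfl fun l' _ => ?_
      rw [inner_smul_left, inner_smul_right, mul_assoc]
      rfl
    rw [Complex.ofReal_sum, Complex.ofReal_sum]
    simp only [h5]
    rw [Finset.sum_comm]
    refine Finset.sum_congr rfl fun l _ => ?_
    rw [Finset.sum_comm]
    simp only [← Finset.mul_sum, h1, mul_ite, mul_one, mul_zero, Finset.sum_ite_eq,
      Finset.mem_univ, if_true]
    rw [Complex.star_def, Complex.conj_mul']
    push_cast
    rfl
  exact_mod_cast h3

/-- The form at `η`, `ξ` is `⟨x, y⟩` in `H^{nm}`, where `x` is `U⋆` applied to `η ⊗ ψ` and `y` is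
`W` applied to `ξ ⊗ ψ`; both keep their norms. -/
theorem norm_le_one_of_mem_vectorSet {comm : Prop} {n m : ℕ}
    {M : Matrix (Fin n × Fin m) (Fin n × Fin m) ℂ} (hM : M ∈ vectorSet.{u} comm n m) :
    ‖M‖ ≤ 1 := by
  obtain ⟨H, _, _, _, U, W, ψ, h, hψ, rfl⟩ := hM
  refine matrix_norm_le_one_of_form _ fun η ξ => ?_
  let x : PiLp 2 fun _ : Fin n × Fin m => H :=
    WithLp.toLp 2 fun p => ∑ i, η (i, p.2) • (star U) p.1 i ψ
  let y : PiLp 2 fun _ : Fin n × Fin m => H :=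
    WithLp.toLp 2 fun p => ∑ l, ξ (p.1, l) • W p.2 l ψ
  have hx : ‖x‖ ^ 2 = ‖WithLp.toLp 2 η‖ ^ 2 := by
    rw [PiLp.norm_sq_eq_of_L2, EuclideanSpace.norm_sq_eq, Fintype.sum_prod_type_right,
      Fintype.sum_prod_type_right]
    exact Finset.sum_congr rfl fun k _ =>
      sum_norm_sq_unitary_apply (Unitary.star_mem h.left_unitary) (fun i => η (i, k)) hψ
  have hy : ‖y‖ ^ 2 = ‖WithLp.toLp 2 ξ‖ ^ 2 := by
    rw [PiLp.norm_sq_eq_of_L2, EuclideanSpace.norm_sq_eq, Fintype.sum_prod_type,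
      Fintype.sum_prod_type]
    exact Finset.sum_congr rfl fun j _ =>
      sum_norm_sq_unitary_apply h.right_unitary (fun l => ξ (j, l)) hψ
  have hxy : ∑ a, ∑ b, star (η a) * ((Matrix.of fun a b : Fin n × Fin m =>
      inner ℂ ψ (U a.1 b.1 (W a.2 b.2 ψ))) a b * ξ b) = inner ℂ x y := by
    have h1 : ∀ p : Fin n × Fin m, inner ℂ (x p) (y p) = ∑ i, ∑ l, star (η (i, p.2)) *
        (inner ℂ ψ (U i p.1 (W p.2 l ψ)) * ξ (p.1, l)) := by
      intro p
      change inner ℂ (∑ i, η (i, p.2) • (star U) p.1 i ψ) (∑ l, ξ (p.1, l) • W p.2 l ψ) = _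
      rw [sum_inner]
      refine Finset.sum_congr rfl fun i _ => ?_
      rw [inner_sum]
      refine Finset.sum_congr rfl fun l _ => ?_
      rw [inner_smul_left, inner_smul_right, Matrix.star_apply,
        ContinuousLinearMap.star_eq_adjoint, ContinuousLinearMap.adjoint_inner_left, mul_comm (ξ _)]
      rfl
    rw [PiLp.inner_apply]
    simp only [h1, Fintype.sum_prod_type, Matrix.of_apply]
    rw [Finset.sum_comm, Finset.sum_comm (s := (Finset.univ : Finset (Fin n)))
      (t := (Finset.univ : Finset (Fin m)))]
    exact Finset.sum_congr rfl fun k _ => Finset.sum_comm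
  rw [hxy, ← hx, ← hy]
  have := norm_inner_le_norm (𝕜 := ℂ) x y
  nlinarith [sq_nonneg (‖x‖ - ‖y‖)]

end UnitaryCorrelation

end

/-! ### The four correlation types -/

theorem mainTheorem5 (t : UnitaryCorrelation.CorrelationType) (n m : ℕ)
    (hn : 1 ≤ n) (hm : 1 ≤ m) :
    {x | UnitaryCorrelation.correlationNorm.{u} t n m x ≤ 1} =
      UnitaryCorrelation.correlationSet.{u} t n m ∧
    UnitaryCorrelation.IsReasonableCrossNorm (UnitaryCorrelation.correlationNorm.{u} t n m) ∧
    ∀ x : UnitaryCorrelation.MatTensor n m,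
      UnitaryCorrelation.operatorNorm x ≤ UnitaryCorrelation.correlationNorm.{u} t n m x := by
  open UnitaryCorrelation OperatorSystem in
  cases t with
  | loc =>
    exact isReasonableCrossNorm_gauge hn hm (image_Bloc.{u} n m) (isClosed_vectorSet _ n m)
      (convex_vectorSet _ n m) (fun _ hM _ hc => smul_mem_vectorSet hM hc)
      (fun _ hU _ hW => kronecker_mem_vectorSet _ hU hW) fun _ => norm_le_one_of_mem_vectorSet
  | qa =>
    exact isReasonableCrossNorm_gauge hn hm (image_Bqa n m)
      (isClosed_functionalImage (pointwiseBounded_minPos _ _) _) (convex_functionalImage _ _ _)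
      (fun _ hM _ hc => smul_mem_functionalImage (C := {x | (V n).MinPos (V m) x})
        (map_rotateV_unit _ hc) (fun _ hx => (isUCPMap_rotateV _ hc).minPos hx) (map_rotateV_genTensor _ hc) hM)
      (fun _ hU _ hW => kronecker_mem_functionalImage_minPos hU hW)
      fun _ hM => norm_le_one_of_mem_functionalImage_maxPos (functionalImage_minPos_subset n m hM)
  | qc =>
    exact isReasonableCrossNorm_gauge hn hm (image_Bqc.{u} n m) (isClosed_vectorSet _ n m)
      (convex_vectorSet _ n m) (fun _ hM _ hc => smul_mem_vectorSet hM hc)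
      (fun _ hU _ hW => kronecker_mem_vectorSet _ hU hW) fun _ => norm_le_one_of_mem_vectorSet
  | qmax =>
    exact isReasonableCrossNorm_gauge hn hm (image_Bqmax n m)
      (isClosed_functionalImage (pointwiseBounded_maxPos _ _) _) (convex_functionalImage _ _ _)
      (fun _ hM _ hc => smul_mem_functionalImage (C := {x | (V n).MaxPos (V m) x})
        (map_rotateV_unit _ hc) (fun _ hx => (isUCPMap_rotateV _ hc).maxPos hx) (map_rotateV_genTensor _ hc) hM)
      (fun _ hU _ hW => functionalImage_minPos_subset n m
        (kronecker_mem_functionalImage_minPos hU hW))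
      fun _ => norm_le_one_of_mem_functionalImage_maxPos
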